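/- Let $d\ge 1$ and $N$ be integers, let $a<0<b$ be real and put $c=\max\{|a|,|b|\}$. Let $P$ be an atomless Borel probability measure on $\mathbb R$ that is concentrated on $[a,b]$ and has mean zero, and write $m_k=\int x^k\,dP(x)$. Let $x_{ij}$ ($1\le i\le N$, $1\le j\le d$) be independent random variables, each with law $P$, let $p_i=(x_{i1},\dots,x_{id})\in\mathbb R^d$, and let $\Delta\in\mathbb R^{N\times N}$, $\Delta_{ij}=\|p_i-p_j\|_2^2$, be the associated Euclidean distance matrix (whose rank is at most $d+2$). Define $$\alpha_0=(m_4m_2-m_2^3-m_3^2)\,d,\qquad \alpha_1=-m_2^3d^2+(m_2^3+m_3^2+m_2^2-m_4-m_4m_2)\,d-m_2,$$ $$\alpha_2=m_2^2d^2+(m_4-m_2^2)\,d+m_2+1,\qquad \alpha_3=-1 .$$ Then the three roots $\lambda_1,\lambda_2,\lambda_3$ (with multiplicity) of the cubic $\alpha_0+\alpha_1\lambda+\alpha_2\lambda^2+\alpha_3\lambda^3$ are real and positive, and $\lambda^*=\min\{\lambda_1,\lambda_2,\lambda_3,m_2\}$ is the smallest eigenvalue of the second-moment matrix $R_d=\mathbb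 E[X_1^{T}X_1]\in\mathbb R^{(d+2)\times(d+2)}$ of the row vector $X_1=(1,p,\|p\|_2^2)$, where $p\in\mathbb R^d$ has independent coordinates with law $P$. Put $$\theta=\frac{1+dc^2+d^2c^4}{\lambda^*}.$$ Let $0<t<1$ and $0<\gamma\le 1$, and suppose that $$N\ \ge\ \frac{2\theta\,(\log(d+2)-\log\gamma)}{(1-t)^2}.$$ Then, with probability at least $1-\gamma$, $\Delta$ has rank $r=d+2$ and obeys the Candès–Recht assumptions with $$\mu_0=\frac{\theta}{t(d+2)},\qquad \mu_1=\frac{\theta}{t\sqrt{d+2}},$$ that is, every compact singular value decomposition $\Delta=\sum_{k=1}^{r}\sigma_k u_kv_k^{T}$ (with $\sigma_k>0$ and with $(u_k)$, $(v_k)$ orthonormal) satisfies (A0) $\max\{\mu(U),\mu(V)\}\le\mu_0$, where $U=\mathrm{span}\{u_k\}$, $V=\mathrm{span}\{v_k\}$ and the coherence of an $r$-dimensional subspace $W\subseteq\mathbb R^N$ with orthogonal projection $P_W$ is $\mu(W)=\frac Nr\max_{i}\|P_We_i\|_2^2$; (A1) $\left|\left(\sum_{k=1}^{r}u_kv_k^{T}\right)_{ij}\right|\le\mu_1\sqrt{r/N^2}$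 for all $i,j$. -/

import Mathlib

open MeasureTheory ProbabilityTheory Polynomial

namespace EDMCoherence

noncomputable section

/-! ### Coherence of subspaces and compact singular value decompositions -/

/-- The coherence `μ(U) = (n / r) * sup_i ‖P_U e_i‖²` of an `r`-dimensional subspace `U` of `ℝⁿ`,
with respect to the standard basis. -/
def coherence {n : ℕ} (U : Submodule ℝ (EuclideanSpace ℝ (Fin n))) : ℝ :=
  (n : ℝ) / (Module.finrank ℝ U : ℝ) *
    ⨆ i : Fin n, ‖U.starProjection (EuclideanSpace.single i (1 : ℝ))‖ ^ 2

/-- A compact singular value decomposition `M = ∑ₖ σₖ uₖ vₖᵀ` of a real `K × L` matrix, with exactly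
`r = rank M` terms, orthonormal `uₖ`, orthonormal `vₖ` and positive `σₖ`. -/
structure CompactSVD {K L : ℕ} (M : Matrix (Fin K) (Fin L) ℝ) where
  u : Fin M.rank → EuclideanSpace ℝ (Fin K)
  v : Fin M.rank → EuclideanSpace ℝ (Fin L)
  σ : Fin M.rank → ℝ
  orthonormal_u : Orthonormal ℝ u
  orthonormal_v : Orthonormal ℝ v
  σ_pos : ∀ k, 0 < σ k
  eq_sum : ∀ i j, M i j = ∑ k, σ k * (u k i * v k j)

/-- The column subspace, spanned by the left singular vectors. -/
def CompactSVD.colSpace {K L : ℕ} {M : Matrix (Fin K) (Fin L) ℝ} (S : CompactSVD M) :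
    Submodule ℝ (EuclideanSpace ℝ (Fin K)) :=
  Submodule.span ℝ (Set.range S.u)

/-- The row subspace, spanned by the right singular vectors. -/
def CompactSVD.rowSpace {K L : ℕ} {M : Matrix (Fin K) (Fin L) ℝ} (S : CompactSVD M) :
    Submodule ℝ (EuclideanSpace ℝ (Fin L)) :=
  Submodule.span ℝ (Set.range S.v)

/-- Assumption A0: both singular subspaces have coherence at most `μ₀`, where `μ₀ > 0`. -/
def CompactSVD.A0 {K L : ℕ} {M : Matrix (Fin K) (Fin L) ℝ} (S : CompactSVD M) (μ₀ : ℝ) : Prop :=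
  0 < μ₀ ∧ max (coherence S.colSpace) (coherence S.rowSpace) ≤ μ₀

/-- Assumption A1: every entry of `∑ₖ uₖ vₖᵀ` is at most `μ₁ √(r / (K L))` in absolute value, where
`μ₁ > 0`. -/
def CompactSVD.A1 {K L : ℕ} {M : Matrix (Fin K) (Fin L) ℝ} (S : CompactSVD M) (μ₁ : ℝ) : Prop :=
  0 < μ₁ ∧ ∀ i j, |∑ k, S.u k i * S.v k j| ≤ μ₁ * √((M.rank : ℝ) / ((K : ℝ) * (L : ℝ)))

/-! ### Euclidean distance matrices -/

/-- The Euclidean distance matrix of `N` points in `ℝᵈ`: its entries are the squared distances. -/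
def edm {N d : ℕ} (p : Fin N → EuclideanSpace ℝ (Fin d)) : Matrix (Fin N) (Fin N) ℝ :=
  Matrix.of fun i j => dist (p i) (p j) ^ 2

/-! ### Moments, the cubic and the constants -/

/-- The `k`-th moment `m_k = ∫ x ^ k dP`. -/
def mom (P : Measure ℝ) (k : ℕ) : ℝ := ∫ x, x ^ k ∂P

/-- The constant coefficient of the cubic. -/
def α₀ (P : Measure ℝ) (d : ℕ) : ℝ :=
  (mom P 4 * mom P 2 - mom P 2 ^ 3 - mom P 3 ^ 2) * d

/-- The linear coefficient of the cubic. -/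
def α₁ (P : Measure ℝ) (d : ℕ) : ℝ :=
  -(mom P 2 ^ 3) * (d : ℝ) ^ 2
    + (mom P 2 ^ 3 + mom P 3 ^ 2 + mom P 2 ^ 2 - mom P 4 - mom P 4 * mom P 2) * d - mom P 2

/-- The quadratic coefficient of the cubic. -/
def α₂ (P : Measure ℝ) (d : ℕ) : ℝ :=
  mom P 2 ^ 2 * (d : ℝ) ^ 2 + (mom P 4 - mom P 2 ^ 2) * d + mom P 2 + 1

/-- The leading coefficient of the cubic. -/
def α₃ : ℝ := -1

/-- The cubic `α₀ + α₁ λ + α₂ λ² + α₃ λ³`. -/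
def cubic (P : Measure ℝ) (d : ℕ) : ℝ[X] :=
  C (α₀ P d) + C (α₁ P d) * X + C (α₂ P d) * X ^ 2 + C α₃ * X ^ 3

/-- `λ*`, the minimum of `m₂` and the real roots of the cubic. -/
def lambdaStar (P : Measure ℝ) (d : ℕ) : ℝ :=
  (insert (mom P 2) (cubic P d).roots.toFinset).min' (Finset.insert_nonempty _ _)

/-- `θ = (1 + d c² + d² c⁴) / λ*`, with `c = max {|a|, |b|}`. -/
def theta (P : Measure ℝ) (d : ℕ) (a b : ℝ) : ℝ :=
  (1 + (d : ℝ) * max |a| |b| ^ 2 + (d : ℝ) ^ 2 * max |a| |b| ^ 4) / lambdaStar P d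

/-- The lifted row `(1, p, ‖p‖²)` of length `d + 2` that belongs to a point `p` of `ℝᵈ`. -/
def liftedRow {d : ℕ} (p : Fin d → ℝ) : Unit ⊕ Fin d ⊕ Unit → ℝ :=
  Sum.elim (fun _ => 1) (Sum.elim p (fun _ => ∑ j, p j ^ 2))

/-- The second-moment matrix `R_d = 𝔼 [(1, p, ‖p‖²)ᵀ (1, p, ‖p‖²)]` of size `d + 2`, for a point `p`
with `d` independent coordinates of law `P`. -/
def secondMoment (P : Measure ℝ) (d : ℕ) :
    Matrix (Unit ⊕ Fin d ⊕ Unit) (Unit ⊕ Fin d ⊕ Unit) ℝ :=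
  Matrix.of fun k l => ∫ p, liftedRow p k * liftedRow p l ∂(Measure.pi fun _ : Fin d => P)

end

end EDMCoherence

/-! Let X be the matrix with rows (1, pᵢ, ‖pᵢ‖²). Expanding the squared distance gives Δ = X A Xᵀ
with a fixed invertible A of size d + 2 (`edm_eq`). Everything follows from one lower bound |Xv|² ≥
t N λ* |v|² for all v. Such a bound makes XᵀX invertible, so Δ has rank d + 2 (`rank_edm`). It also
controls the column space: if w = Xv and every row has squared length at most B, then wᵢ² ≤ B|v|² ≤
(B / (t N λ*)) ‖w‖² (`sq_apply_le_of_mem_range`). Applied to projections of basis vectors this gives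
A0, and with Cauchy–Schwarz it gives A1.

The lower bound holds with high probability because XᵀX is a sum of N independent copies of a
bounded rank-one matrix with mean R_d, whose least eigenvalue is λ*. The matrix Chernoff bound is
proved by removing one summand at a time with the Golden–Thompson inequality
(`lintegral_trace_exp_sum_le`). For identically distributed summands this loses nothing in the
exponent, as the least eigenvalue of the mean of the sum is N times that of one mean.

To identify λ*, note that R_d couples the d middle coordinates to the others only through their sum.
On vectors constant in these coordinates R_d is a symmetric 3 × 3 matrix with characteristic
polynomial minus the cubic; on the sum-zero vectors it is m₂ times the identity
(`isLeast_lambdaStar`). -/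

section

open Filter Topology

/-! ### The Lie–Trotter product formula -/

section LieTrotter

variable {𝔸 : Type*} [NormedRing 𝔸] [NormOneClass 𝔸]

/-- Telescoping, exchanging one factor at a time. Having M ^ n rather than M ^ (n - 1) is harmless:
M will be exp (c / n). -/
theorem norm_pow_sub_pow_le_of_norm_le {x y : 𝔸} {M : ℝ} (hM : 1 ≤ M) (hx : ‖x‖ ≤ M)
    (hy : ‖y‖ ≤ M) (n : ℕ) : ‖x ^ n - y ^ n‖ ≤ n * M ^ n * ‖x - y‖ := by
  induction n with
  | zero => simp
  | succ n ih =>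
    have hM0 : 0 ≤ M := zero_le_one.trans hM
    have h1 : x ^ (n + 1) - y ^ (n + 1) = x ^ n * (x - y) + (x ^ n - y ^ n) * y := by
      rw [pow_succ, pow_succ]; noncomm_ring
    have h2 : ‖x ^ n * (x - y)‖ ≤ M ^ (n + 1) * ‖x - y‖ := by
      refine (norm_mul_le _ _).trans ?_
      gcongr
      calc ‖x ^ n‖ ≤ ‖x‖ ^ n := norm_pow_le _ _
        _ ≤ M ^ n := by gcongr
        _ ≤ M ^ (n + 1) := pow_le_pow_right₀ hM (Nat.le_succ n)
    have h3 : ‖(x ^ n - y ^ n) * y‖ ≤ n * M ^ (n + 1) * ‖x - y‖ := by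
      refine (norm_mul_le _ _).trans ?_
      calc ‖x ^ n - y ^ n‖ * ‖y‖ ≤ (n * M ^ n * ‖x - y‖) * M := by gcongr
        _ = _ := by ring
    calc ‖x ^ (n + 1) - y ^ (n + 1)‖ ≤ M ^ (n + 1) * ‖x - y‖ + n * M ^ (n + 1) * ‖x - y‖ := by
          rw [h1]; exact (norm_add_le _ _).trans (add_le_add h2 h3)
      _ = _ := by push_cast; ring

variable [NormedAlgebra ℝ 𝔸] [CompleteSpace 𝔸]

theorem norm_normedSpaceExp_le (x : 𝔸) : ‖NormedSpace.exp x‖ ≤ Real.exp ‖x‖ := by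
  have h2 := NormedSpace.exp_series_hasSum_exp' (𝕂 := ℝ) ‖x‖
  rw [← Real.exp_eq_exp_ℝ] at h2
  refine (NormedSpace.exp_series_hasSum_exp' (𝕂 := ℝ) x).norm_le_of_bounded h2 fun n => ?_
  rw [norm_smul, smul_eq_mul, norm_inv, Real.norm_natCast]
  gcongr
  exact norm_pow_le x n

/-- The Lie–Trotter product formula, along a sequence of exponents that tends to infinity. -/
theorem tendsto_exp_mul_exp_pow (a b : 𝔸) {u : ℕ → ℕ} (hu : Tendsto u atTop atTop) :
    Tendsto (fun k => (NormedSpace.exp ((u k : ℝ)⁻¹ • a) * NormedSpace.exp ((u k : ℝ)⁻¹ • b)) ^ u k)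
      atTop (𝓝 (NormedSpace.exp (a + b))) := by
  let : NormedAlgebra ℚ 𝔸 := NormedAlgebra.restrictScalars ℚ ℝ 𝔸
  -- Both f and its derivative vanish at 0, so n‖f (1/n)‖ tends to 0, which absorbs the factor n of
  -- the telescoping bound.
  set f : ℝ → 𝔸 := fun s =>
    NormedSpace.exp (s • a) * NormedSpace.exp (s • b) - NormedSpace.exp (s • (a + b)) with hf
  have hd : HasDerivAt f 0 0 := by
    have h := ((hasDerivAt_exp_smul_const (𝕂 := ℝ) a 0).mul
      (hasDerivAt_exp_smul_const (𝕂 := ℝ) b 0)).sub (hasDerivAt_exp_smul_const (𝕂 := ℝ) (a + b) 0)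
    have h0 : f = ((fun s : ℝ => NormedSpace.exp (s • a)) * fun s : ℝ => NormedSpace.exp (s • b)) -
        fun s : ℝ => NormedSpace.exp (s • (a + b)) := rfl
    rw [h0]
    refine h.congr_deriv ?_
    simp
  have hu' : Tendsto (fun k => ((u k : ℝ))⁻¹) atTop (𝓝[≠] 0) := by
    refine tendsto_nhdsWithin_iff.2
      ⟨tendsto_inv_atTop_zero.comp (tendsto_natCast_atTop_atTop.comp hu), ?_⟩
    filter_upwards [hu.eventually_ge_atTop 1] with k hk
    have : (u k : ℝ) ≠ 0 := by exact_mod_cast (by lia : u k ≠ 0)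
    simpa using this
  have hlim : Tendsto (fun k => (u k : ℝ) * ‖f (u k : ℝ)⁻¹‖) atTop (𝓝 0) := by
    have h := ((hasDerivAt_iff_tendsto_slope_zero.1 hd).comp hu').norm
    have hf0 : f 0 = 0 := by simp [hf]
    simpa [Function.comp_def, hf0, norm_smul] using h
  set c : ℝ := ‖a‖ + ‖b‖
  rw [tendsto_iff_norm_sub_tendsto_zero]
  refine squeeze_zero' (Eventually.of_forall fun _ => norm_nonneg _) ?_
    (by simpa using hlim.const_mul (Real.exp c))
  filter_upwards [hu.eventually_ge_atTop 1] with k hk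
  have hk0 : (0 : ℝ) < u k := by exact_mod_cast hk
  have hnorm : ∀ x : 𝔸, ‖NormedSpace.exp x‖ ≤ Real.exp ‖x‖ := norm_normedSpaceExp_le
  have hsm : ∀ x : 𝔸, ‖(u k : ℝ)⁻¹ • x‖ = (u k : ℝ)⁻¹ * ‖x‖ := fun x => by
    rw [norm_smul, Real.norm_of_nonneg (by positivity)]
  have hpow : NormedSpace.exp (a + b) = (NormedSpace.exp ((u k : ℝ)⁻¹ • (a + b))) ^ u k := by
    rw [← NormedSpace.exp_nsmul, ← Nat.cast_smul_eq_nsmul ℝ, smul_smul, mul_inv_cancel₀ hk0.ne',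
      one_smul]
  rw [hpow]
  have hM : 1 ≤ Real.exp ((u k : ℝ)⁻¹ * c) := Real.one_le_exp (by positivity)
  refine (norm_pow_sub_pow_le_of_norm_le hM ?_ ?_ (u k)).trans (le_of_eq ?_)
  · refine (norm_mul_le _ _).trans ?_
    rw [mul_add, Real.exp_add]
    exact mul_le_mul ((hnorm _).trans_eq (by rw [hsm])) ((hnorm _).trans_eq (by rw [hsm]))
      (norm_nonneg _) (Real.exp_pos _).le
  · refine (hnorm _).trans (Real.exp_le_exp.2 ?_)
    rw [hsm]
    gcongr
    exact norm_add_le _ _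
  · rw [← Real.exp_nat_mul, ← mul_assoc (u k : ℝ), mul_inv_cancel₀ hk0.ne', one_mul]
    ring

end LieTrotter

namespace Matrix

variable {n : Type*} [Fintype n]

/-! ### Trace inequalities and the Golden–Thompson inequality -/

theorem trace_mul_transpose_self (A : Matrix n n ℝ) : (A * Aᵀ).trace = ∑ i, ∑ j, A i j ^ 2 := by
  simp [trace, mul_apply, sq]

theorem two_mul_trace_mul_transpose_le (A B : Matrix n n ℝ) :
    2 * (A * Bᵀ).trace ≤ (A * Aᵀ).trace + (B * Bᵀ).trace := by
  have h : 0 ≤ ((A - B) * (A - B)ᵀ).trace := by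
    rw [trace_mul_transpose_self]; positivity
  have h2 : (B * Aᵀ).trace = (A * Bᵀ).trace := by
    rw [← trace_transpose, transpose_mul, transpose_transpose]
  simp only [transpose_sub, sub_mul, mul_sub, trace_sub] at h
  linarith

variable [DecidableEq n]

theorem trace_mul_pow_comm (A B : Matrix n n ℝ) (k : ℕ) :
    ((A * B) ^ k).trace = ((B * A) ^ k).trace := by
  cases k with
  | zero => simp
  | succ k => rw [pow_succ, ← mul_assoc, mul_pow_mul, trace_mul_comm, ← mul_assoc, ← pow_succ']

/-- The two inequalities feed each other. The first at k + 1 is the second at k for M = AB, since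
(AB)(AB)ᵀ is cyclically A²B², followed by the first at k. The second at k + 1 is the second at k for
M², then the first at k for MᵀM and MMᵀ, then 2 tr PQ ≤ tr P² + tr Q². Only symmetry is needed, not
positivity. -/
theorem trace_pow_le_aux (k : ℕ) :
    (∀ A B : Matrix n n ℝ, A.IsSymm → B.IsSymm →
      ((A * B) ^ 2 ^ k).trace ≤ (A ^ 2 ^ k * B ^ 2 ^ k).trace) ∧
    ∀ M : Matrix n n ℝ, (M ^ 2 ^ (k + 1)).trace ≤ ((M * Mᵀ) ^ 2 ^ k).trace := by
  induction k with
  | zero =>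
    refine ⟨fun A B _ _ => by simp, fun M => ?_⟩
    have h := two_mul_trace_mul_transpose_le M Mᵀ
    rw [transpose_transpose, trace_mul_comm Mᵀ M] at h
    simp only [zero_add, pow_one, pow_zero, sq]
    linarith
  | succ k ih =>
    obtain ⟨ihG, ihC⟩ := ih
    refine ⟨fun A B hA hB => ?_, fun M => ?_⟩
    · refine (ihC (A * B)).trans ?_
      have h1 : ((A * B * (A * B)ᵀ) ^ 2 ^ k).trace = ((A ^ 2 * B ^ 2) ^ 2 ^ k).trace := by
        rw [transpose_mul, hA.eq, hB.eq, mul_assoc, trace_mul_pow_comm, sq, sq,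
          trace_mul_pow_comm (A * A)]
        simp only [mul_assoc]
      rw [h1]
      refine (ihG _ _ (hA.pow 2) (hB.pow 2)).trans_eq ?_
      rw [← pow_mul, ← pow_mul, ← pow_succ']
    · have h1 : M ^ 2 ^ (k + 1 + 1) = (M ^ 2) ^ 2 ^ (k + 1) := by rw [← pow_mul, ← pow_succ']
      rw [h1]
      refine (ihC (M ^ 2)).trans ?_
      have hP : (Mᵀ * M).IsSymm := by simp [IsSymm]
      have hQ : (M * Mᵀ).IsSymm := by simp [IsSymm]
      have h2 : ((M ^ 2 * (M ^ 2)ᵀ) ^ 2 ^ k).trace = (((Mᵀ * M) * (M * Mᵀ)) ^ 2 ^ k).trace := by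
        rw [sq, transpose_mul, ← mul_assoc, trace_mul_pow_comm]
        simp only [mul_assoc]
      rw [h2]
      refine (ihG _ _ hP hQ).trans ?_
      have h3 := two_mul_trace_mul_transpose_le ((Mᵀ * M) ^ 2 ^ k) ((M * Mᵀ) ^ 2 ^ k)
      rw [(hP.pow _).eq, (hQ.pow _).eq, ← pow_add, ← pow_add, trace_mul_pow_comm Mᵀ,
        ← two_mul (2 ^ k), ← _root_.pow_succ'] at h3
      linarith

section Exp

/-- Golden–Thompson: apply the power inequality to exp (A / 2ᵏ) and exp (B / 2ᵏ), then pass to the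
Lie–Trotter limit along powers of two. -/
theorem trace_exp_add_le [Nonempty n] {A B : Matrix n n ℝ} (hA : A.IsSymm) (hB : B.IsSymm) :
    (NormedSpace.exp (A + B)).trace ≤ (NormedSpace.exp A * NormedSpace.exp B).trace := by
  open scoped Norms.Operator in
  have hu : Tendsto (fun k : ℕ => 2 ^ k) atTop atTop :=
    tendsto_pow_atTop_atTop_of_one_lt one_lt_two
  have h := tendsto_exp_mul_exp_pow A B hu
  have ht : Continuous (trace : Matrix n n ℝ → ℝ) := continuous_id.matrix_trace
  refine le_of_tendsto ((ht.tendsto _).comp h) (Eventually.of_forall fun k => ?_)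
  have hp : ∀ C : Matrix n n ℝ,
      NormedSpace.exp (((2 ^ k : ℕ) : ℝ)⁻¹ • C) ^ 2 ^ k = NormedSpace.exp C := fun C => by
    rw [← Matrix.exp_nsmul, ← Nat.cast_smul_eq_nsmul ℝ, smul_smul, mul_inv_cancel₀ (by positivity),
      one_smul]
  have hs := (trace_pow_le_aux k).1 _ _ (hA.smul ((2 ^ k : ℕ) : ℝ)⁻¹).exp
    (hB.smul ((2 ^ k : ℕ) : ℝ)⁻¹).exp
  rwa [hp, hp] at hs

theorem exp_smul_of_isIdempotentElem {E : Matrix n n ℝ} (hE : IsIdempotentElem E) (a : ℝ) :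
    NormedSpace.exp (a • E) = 1 + (Real.exp a - 1) • E := by
  open scoped Norms.Operator in
  have h1 := NormedSpace.exp_series_hasSum_exp' (𝕂 := ℝ) (a • E)
  have h2 := (NormedSpace.exp_series_hasSum_exp' (𝕂 := ℝ) a).smul_const E
  rw [← Real.exp_eq_exp_ℝ] at h2
  -- The series of exp a times E is wrong only at k = 0, where E stands in place of 1.
  have h3 := h2.add (hasSum_ite_eq 0 (1 - E))
  have h4 : Real.exp a • E + (1 - E) = 1 + (Real.exp a - 1) • E := by
    rw [sub_smul, one_smul]; abel
  rw [← h4]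
  refine h1.unique ((congrArg (HasSum · _) (funext fun k => ?_)).mpr h3)
  cases k with
  | zero => simp
  | succ k =>
    have hk : E ^ (k + 1) = E := hE.pow_succ_eq k
    simp [_root_.smul_pow, smul_smul, hk]

theorem exp_smul_vecMulVec (a : ℝ) {x : n → ℝ} (hx : x ≠ 0) :
    NormedSpace.exp (a • vecMulVec x x) =
      1 + ((Real.exp (a * (x ⬝ᵥ x)) - 1) / (x ⬝ᵥ x)) • vecMulVec x x := by
  have hq : x ⬝ᵥ x ≠ 0 := by simpa using hx
  have hE : IsIdempotentElem ((x ⬝ᵥ x)⁻¹ • vecMulVec x x) := by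
    rw [IsIdempotentElem, smul_mul_smul_comm, vecMulVec_mul_vecMulVec, vecMulVec_smul, smul_smul]
    congr 1
    field_simp
  have h := exp_smul_of_isIdempotentElem hE (a * (x ⬝ᵥ x))
  rwa [smul_smul, mul_assoc, mul_inv_cancel₀ hq, mul_one, smul_smul, ← div_eq_mul_inv] at h

omit [DecidableEq n] in
theorem trace_mul_vecMulVec_self (C : Matrix n n ℝ) (x : n → ℝ) :
    (C * vecMulVec x x).trace = x ⬝ᵥ C *ᵥ x := by
  rw [mul_vecMulVec, trace_vecMulVec, dotProduct_comm]

/-- On [0, L] the convex function q ↦ exp (-sq) lies below its chord. This makes the bound linear in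
x xᵀ, so that an expectation can be taken. -/
theorem trace_mul_exp_vecMulVec_le {C : Matrix n n ℝ} {x : n → ℝ} {L s : ℝ} (hL : 0 < L)
    (hx : x ⬝ᵥ x ≤ L) (hC : 0 ≤ x ⬝ᵥ C *ᵥ x) :
    (C * NormedSpace.exp (-s • vecMulVec x x)).trace ≤
      C.trace - (1 - Real.exp (-s * L)) / L * (x ⬝ᵥ C *ᵥ x) := by
  rcases eq_or_ne x 0 with rfl | hx0
  · simp
  have hq : 0 < x ⬝ᵥ x := lt_of_le_of_ne (by simpa using dotProduct_star_self_nonneg x) (by simpa [eq_comm] using hx0)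
  rw [exp_smul_vecMulVec _ hx0, mul_add, mul_one, mul_smul_comm, trace_add, trace_smul,
    trace_mul_vecMulVec_self, smul_eq_mul]
  set q := x ⬝ᵥ x
  have hconv := convexOn_exp.2 (Set.mem_univ 0) (Set.mem_univ (-s * L))
    (sub_nonneg.2 ((div_le_one hL).2 hx)) (by positivity : 0 ≤ q / L) (by ring)
  have he : (1 - q / L) • (0 : ℝ) + (q / L) • (-s * L) = -s * q := by
    simp only [smul_eq_mul]; field_simp; ring
  rw [he] at hconv
  simp only [smul_eq_mul, Real.exp_zero] at hconv
  have h1 : (Real.exp (-s * q) - 1) / q ≤ -((1 - Real.exp (-s * L)) / L) := by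
    rw [div_le_iff₀ hq]
    calc _ ≤ (1 - q / L) * 1 + q / L * Real.exp (-s * L) - 1 := by linarith
      _ = _ := by field_simp; ring
  nlinarith [mul_le_mul_of_nonneg_right h1 hC]

theorem IsHermitian.trace_exp {A : Matrix n n ℝ} (hA : A.IsHermitian) :
    (NormedSpace.exp A).trace = ∑ i, Real.exp (hA.eigenvalues i) := by
  have h := hA.spectral_theorem
  rw [Unitary.conjStarAlgAut_apply] at h
  set U : Matrix n n ℝ := (hA.eigenvectorUnitary : Matrix n n ℝ) with hU
  have hUU : U * star U = 1 := Unitary.coe_mul_star_self _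
  have hUU' : star U * U = 1 := Unitary.coe_star_mul_self _
  have hinv : U⁻¹ = star U := inv_eq_right_inv hUU
  have hunit : IsUnit U := ⟨⟨U, star U, hUU, hUU'⟩, rfl⟩
  rw [← hinv] at h
  nth_rewrite 1 [h]
  rw [exp_conj _ _ hunit, trace_mul_cycle, hinv, hUU', one_mul, exp_diagonal, trace_diagonal]
  refine Finset.sum_congr rfl fun i _ => ?_
  rw [Pi.coe_exp, Real.exp_eq_exp_ℝ]
  rfl

end Exp

end Matrix

end

namespace Matrix

variable {n : Type*} [Fintype n] [DecidableEq n]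

/-! ### Quadratic forms and eigenvalues -/

theorem IsHermitian.exists_coord {A : Matrix n n ℝ} (hA : A.IsHermitian) (v : n → ℝ) :
    ∃ w : n → ℝ, v ⬝ᵥ A *ᵥ v = ∑ i, hA.eigenvalues i * w i ^ 2 ∧ v ⬝ᵥ v = ∑ i, w i ^ 2 := by
  have h := hA.spectral_theorem
  rw [Unitary.conjStarAlgAut_apply] at h
  set U : Matrix n n ℝ := (hA.eigenvectorUnitary : Matrix n n ℝ) with hU
  have hUU : U * star U = 1 := Unitary.coe_mul_star_self _
  have hs : star U = Uᵀ := by rw [star_eq_conjTranspose, conjTranspose_eq_transpose_of_trivial]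
  rw [hs] at h hUU
  refine ⟨Uᵀ *ᵥ v, ?_, ?_⟩
  · nth_rewrite 1 [h]
    rw [← mulVec_mulVec, ← mulVec_mulVec, dotProduct_mulVec, ← mulVec_transpose]
    simp only [dotProduct, mulVec_diagonal, Function.comp_apply, RCLike.ofReal_real_eq_id, id]
    exact Finset.sum_congr rfl fun i _ => by ring
  · calc v ⬝ᵥ v = v ⬝ᵥ (U * Uᵀ) *ᵥ v := by rw [hUU, one_mulVec]
      _ = (Uᵀ *ᵥ v) ⬝ᵥ (Uᵀ *ᵥ v) := by
        rw [← mulVec_mulVec, dotProduct_mulVec, ← mulVec_transpose]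
      _ = _ := by simp [dotProduct, sq]

theorem IsHermitian.le_dotProduct_mulVec {A : Matrix n n ℝ} (hA : A.IsHermitian) {l : ℝ}
    (h : ∀ i, l ≤ hA.eigenvalues i) (v : n → ℝ) : l * (v ⬝ᵥ v) ≤ v ⬝ᵥ A *ᵥ v := by
  obtain ⟨w, h1, h2⟩ := hA.exists_coord v
  rw [h1, h2, Finset.mul_sum]
  exact Finset.sum_le_sum fun i _ => mul_le_mul_of_nonneg_right (h i) (sq_nonneg _)

theorem IsHermitian.dotProduct_mulVec_le {A : Matrix n n ℝ} (hA : A.IsHermitian) {l : ℝ}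
    (h : ∀ i, hA.eigenvalues i ≤ l) (v : n → ℝ) : v ⬝ᵥ A *ᵥ v ≤ l * (v ⬝ᵥ v) := by
  obtain ⟨w, h1, h2⟩ := hA.exists_coord v
  rw [h1, h2, Finset.mul_sum]
  exact Finset.sum_le_sum fun i _ => mul_le_mul_of_nonneg_right (h i) (sq_nonneg _)

/-- The trace of exp A dominates each exp λᵢ, so a scalar bound on it controls the largest
eigenvalue. -/
theorem IsHermitian.dotProduct_mulVec_le_of_trace_exp_le {A : Matrix n n ℝ} (hA : A.IsHermitian)
    {l : ℝ} (h : (NormedSpace.exp A).trace ≤ Real.exp l) (v : n → ℝ) :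
    v ⬝ᵥ A *ᵥ v ≤ l * (v ⬝ᵥ v) := by
  refine hA.dotProduct_mulVec_le (fun i => Real.exp_le_exp.1 (le_trans ?_ h)) v
  rw [hA.trace_exp]
  exact Finset.single_le_sum (f := fun i => Real.exp (hA.eigenvalues i))
    (fun j _ => (Real.exp_pos _).le) (Finset.mem_univ i)

theorem IsHermitian.trace_exp_nonneg {A : Matrix n n ℝ} (hA : A.IsHermitian) :
    0 ≤ (NormedSpace.exp A).trace := by
  rw [hA.trace_exp]
  exact Finset.sum_nonneg fun j _ => (Real.exp_pos _).le

/-! ### The lower matrix Chernoff bound for rank-one summands -/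

/-- With D = exp (S / 2), the form of exp S is a sum of squares (v · D k)², to which second-moment
bounds along single vectors apply. -/
theorem IsSymm.exists_exp_eq {S : Matrix n n ℝ} (hS : S.IsSymm) :
    ∃ D : Matrix n n ℝ, NormedSpace.exp S = Dᵀ * D := by
  refine ⟨NormedSpace.exp ((2 : ℝ)⁻¹ • S), ?_⟩
  rw [(hS.smul _).exp.eq, ← exp_add_of_commute _ _ (Commute.refl _), ← add_smul]
  norm_num

omit [DecidableEq n] in
theorem dotProduct_transpose_mul_self_mulVec (D : Matrix n n ℝ) (v : n → ℝ) :
    v ⬝ᵥ (Dᵀ * D) *ᵥ v = ∑ k, (v ⬝ᵥ D k) ^ 2 := by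
  rw [← mulVec_mulVec, dotProduct_mulVec, vecMul_transpose]
  simp [dotProduct, mulVec, sq, mul_comm]

omit [DecidableEq n] in
theorem trace_transpose_mul_self' (D : Matrix n n ℝ) : (Dᵀ * D).trace = ∑ k, D k ⬝ᵥ D k := by
  rw [trace_mul_comm]
  simp [trace, mul_apply, dotProduct]

theorem isSymm_vecMulVec_self {n : Type*} (x : n → ℝ) : (vecMulVec x x).IsSymm := by
  rw [IsSymm, transpose_vecMulVec]

section Chernoff

variable {E : Type*} [MeasurableSpace E] {ν : Measure E} [IsProbabilityMeasure ν] {φ : E → n → ℝ}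
  {L lam : ℝ}

omit [DecidableEq n] [IsProbabilityMeasure ν] in
theorem measurable_dotProduct_const (hφ : Measurable φ) (v : n → ℝ) :
    Measurable fun p => φ p ⬝ᵥ v :=
  (by unfold dotProduct; fun_prop : Continuous fun w : n → ℝ => w ⬝ᵥ v).measurable.comp hφ

omit [DecidableEq n] in
theorem sq_dotProduct_le (v w : n → ℝ) : (v ⬝ᵥ w) ^ 2 ≤ (v ⬝ᵥ v) * (w ⬝ᵥ w) := by
  have h := Finset.sum_mul_sq_le_sq_mul_sq Finset.univ v w
  simpa [dotProduct, sq] using h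

omit [DecidableEq n] in
theorem integrable_sq_dotProduct (hφ : Measurable φ) (hL : ∀ᵐ p ∂ν, φ p ⬝ᵥ φ p ≤ L)
    (v : n → ℝ) : Integrable (fun p => (φ p ⬝ᵥ v) ^ 2) ν := by
  refine Integrable.of_bound ((measurable_dotProduct_const hφ v).pow_const 2).aestronglyMeasurable
    (L * (v ⬝ᵥ v)) ?_
  filter_upwards [hL] with p hp
  rw [Real.norm_of_nonneg (sq_nonneg _)]
  have h0 : 0 ≤ v ⬝ᵥ v := by simpa using dotProduct_star_self_nonneg v
  exact (sq_dotProduct_le _ _).trans (mul_le_mul_of_nonneg_right hp h0)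

/-- One random summand contributes a scalar factor: Golden–Thompson splits it off, the chord bound
makes it linear, and its mean is at most (1 - c lam) tr exp S ≤ exp (-c lam) tr exp S. -/
theorem lintegral_trace_exp_add_le [Nonempty n] (hφ : Measurable φ) (hL0 : 0 < L)
    (hL : ∀ᵐ p ∂ν, φ p ⬝ᵥ φ p ≤ L) (hlam : ∀ v : n → ℝ, lam * (v ⬝ᵥ v) ≤ ∫ p, (φ p ⬝ᵥ v) ^ 2 ∂ν)
    {s : ℝ} (hs : 0 ≤ s) {S : Matrix n n ℝ} (hS : S.IsSymm) :
    ∫⁻ q, ENNReal.ofReal (NormedSpace.exp (S + -s • vecMulVec (φ q) (φ q))).trace ∂ν ≤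
      ENNReal.ofReal (Real.exp (-((1 - Real.exp (-s * L)) / L * lam))) *
        ENNReal.ofReal (NormedSpace.exp S).trace := by
  obtain ⟨D, hD⟩ := hS.exists_exp_eq
  set c := (1 - Real.exp (-s * L)) / L with hc
  have hc0 : 0 ≤ c := div_nonneg (sub_nonneg.2 (Real.exp_le_one_iff.2 (by nlinarith))) hL0.le
  have hint : Integrable (fun q => φ q ⬝ᵥ (Dᵀ * D) *ᵥ φ q) ν := by
    simp only [dotProduct_transpose_mul_self_mulVec]
    exact integrable_finsetSum _ fun k _ => integrable_sq_dotProduct hφ hL (D k)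
  have hle : ∀ᵐ q ∂ν, (NormedSpace.exp (S + -s • vecMulVec (φ q) (φ q))).trace ≤
      (Dᵀ * D).trace - c * (φ q ⬝ᵥ (Dᵀ * D) *ᵥ φ q) := by
    filter_upwards [hL] with q hq
    refine (trace_exp_add_le hS ((isSymm_vecMulVec_self _).smul _)).trans ?_
    rw [hD]
    refine trace_mul_exp_vecMulVec_le hL0 hq ?_
    rw [dotProduct_transpose_mul_self_mulVec]
    positivity
  have h0 : ∀ q, 0 ≤ (NormedSpace.exp (S + -s • vecMulVec (φ q) (φ q))).trace := fun q =>
    IsHermitian.trace_exp_nonneg (isHermitian_iff_isSymm.2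
      (hS.add ((isSymm_vecMulVec_self _).smul _)))
  have hint2 := (integrable_const (μ := ν) (Dᵀ * D).trace).sub (hint.const_mul c)
  calc _ ≤ ∫⁻ q, ENNReal.ofReal ((Dᵀ * D).trace - c * (φ q ⬝ᵥ (Dᵀ * D) *ᵥ φ q)) ∂ν :=
        lintegral_mono_ae (hle.mono fun q hq => ENNReal.ofReal_le_ofReal hq)
    _ = ENNReal.ofReal (∫ q, ((Dᵀ * D).trace - c * (φ q ⬝ᵥ (Dᵀ * D) *ᵥ φ q)) ∂ν) :=
        (ofReal_integral_eq_lintegral_ofReal hint2 (hle.mono fun q hq => (h0 q).trans hq)).symm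
    _ ≤ _ := by
      rw [← ENNReal.ofReal_mul (Real.exp_pos _).le]
      apply ENNReal.ofReal_le_ofReal
      rw [integral_sub (integrable_const _) (hint.const_mul c), integral_const_mul, hD]
      simp only [dotProduct_transpose_mul_self_mulVec, integral_const, probReal_univ, one_smul]
      rw [integral_finsetSum _ fun k _ => integrable_sq_dotProduct hφ hL (D k)]
      have h1 : lam * (Dᵀ * D).trace ≤ ∑ k, ∫ p, (φ p ⬝ᵥ D k) ^ 2 ∂ν := by
        rw [trace_transpose_mul_self', Finset.mul_sum]
        exact Finset.sum_le_sum fun k _ => hlam (D k)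
      have h2 : 0 ≤ (Dᵀ * D).trace := by
        rw [trace_mul_comm, trace_mul_transpose_self]; positivity
      have h3 := Real.add_one_le_exp (-(c * lam))
      nlinarith [mul_le_mul_of_nonneg_left h1 hc0, mul_le_mul_of_nonneg_right h3 h2]

omit [Fintype n] [DecidableEq n] in
theorem isSymm_sum_smul_vecMulVec {ι : Type*} [Fintype ι] (s : ℝ) (f : ι → n → ℝ) :
    (∑ i, s • vecMulVec (f i) (f i)).IsSymm := by
  rw [IsSymm, transpose_sum]
  exact Finset.sum_congr rfl fun i _ => ((isSymm_vecMulVec_self _).smul s).eq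

theorem measurable_trace_exp_sum (hφ : Measurable φ) {ι : Type*} [Fintype ι] (s : ℝ) :
    Measurable fun p : ι → E =>
      (NormedSpace.exp (∑ i, s • vecMulVec (φ (p i)) (φ (p i)))).trace := by
  have hc : Continuous fun f : ι → n → ℝ =>
      (NormedSpace.exp (∑ i, s • vecMulVec (f i) (f i))).trace := by
    have he : Continuous (NormedSpace.exp : Matrix n n ℝ → Matrix n n ℝ) := by
      open scoped Norms.Operator in
      let : NormedAlgebra ℚ (Matrix n n ℝ) := NormedAlgebra.restrictScalars ℚ ℝ _
      exact NormedSpace.exp_continuous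
    refine (he.comp ?_).matrix_trace
    refine continuous_finsetSum _ fun i _ => Continuous.const_smul ?_ s
    exact Continuous.matrix_vecMulVec (continuous_apply i) (continuous_apply i)
  exact hc.measurable.comp (measurable_pi_lambda _ fun i => hφ.comp (measurable_pi_apply i))

omit [Fintype n] [DecidableEq n] in
theorem lintegral_pi_fin_succ {N : ℕ} {g : (Fin (N + 1) → E) → ENNReal} (hg : Measurable g) :
    ∫⁻ p, g p ∂(Measure.pi fun _ : Fin (N + 1) => ν) =
      ∫⁻ p, ∫⁻ q, g (Fin.cons q p) ∂ν ∂(Measure.pi fun _ : Fin N => ν) := by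
  have hmp := (measurePreserving_piFinSuccAbove (fun _ : Fin (N + 1) => ν) 0).symm
  rw [← hmp.lintegral_comp hg]
  refine (lintegral_prod_symm' _ (hg.comp hmp.measurable)).trans ?_
  simp [MeasurableEquiv.piFinSuccAbove]
  rfl

theorem lintegral_trace_exp_sum_le [Nonempty n] (hφ : Measurable φ) (hL0 : 0 < L)
    (hL : ∀ᵐ p ∂ν, φ p ⬝ᵥ φ p ≤ L) (hlam : ∀ v : n → ℝ, lam * (v ⬝ᵥ v) ≤ ∫ p, (φ p ⬝ᵥ v) ^ 2 ∂ν)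
    {s : ℝ} (hs : 0 ≤ s) (N : ℕ) :
    ∫⁻ p, ENNReal.ofReal (NormedSpace.exp (∑ i, -s • vecMulVec (φ (p i)) (φ (p i)))).trace
        ∂(Measure.pi fun _ : Fin N => ν) ≤
      ENNReal.ofReal (Real.exp (-((1 - Real.exp (-s * L)) / L * lam))) ^ N * Fintype.card n := by
  induction N with
  | zero => simp
  | succ N ih =>
    rw [lintegral_pi_fin_succ (measurable_trace_exp_sum hφ (-s)).ennreal_ofReal]
    simp only [Fin.sum_univ_succ, Fin.cons_zero, Fin.cons_succ]
    simp only [add_comm (-s • vecMulVec _ _)]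
    have hstep := fun p : Fin N → E => lintegral_trace_exp_add_le hφ hL0 hL hlam hs
      (isSymm_sum_smul_vecMulVec (-s) fun i => φ (p i))
    have hm := (measurable_trace_exp_sum hφ (ι := Fin N) (-s)).ennreal_ofReal
    refine (lintegral_mono hstep).trans ?_
    rw [lintegral_const_mul _ hm, pow_succ', mul_assoc]
    gcongr

theorem half_sq_one_sub_le {t : ℝ} (ht0 : 0 < t) (ht1 : t ≤ 1) :
    (1 - t) ^ 2 / 2 ≤ t * Real.log t - t + 1 := by
  have hanti : AntitoneOn (fun x : ℝ => x * Real.log x - x + 1 - (1 - x) ^ 2 / 2) (Set.Ioc 0 1) := by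
    have hd : ∀ x : ℝ, 0 < x → HasDerivAt
        (fun x : ℝ => x * Real.log x - x + 1 - (1 - x) ^ 2 / 2) (Real.log x - (x - 1)) x := by
      intro x hx
      have h := ((((hasDerivAt_id x).mul (Real.hasDerivAt_log hx.ne')).sub (hasDerivAt_id x)).add_const
        -- The derivative log x - (x - 1) is nonpositive and the function vanishes at 1.
        1).sub ((((hasDerivAt_const x (1 : ℝ)).sub (hasDerivAt_id x)).pow 2).div_const 2)
      refine HasDerivAt.congr_deriv (f := fun x : ℝ => x * Real.log x - x + 1 - (1 - x) ^ 2 / 2) h ?_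
      simp only [id, Pi.sub_apply]
      field_simp
      ring
    refine antitoneOn_of_deriv_nonpos (convex_Ioc 0 1)
      (fun x hx => (hd x hx.1).continuousAt.continuousWithinAt)
      (fun x hx => (hd x (interior_subset hx).1).differentiableAt.differentiableWithinAt) ?_
    intro x hx
    have hx0 := (interior_subset hx).1
    rw [(hd x hx0).deriv]
    linarith [Real.log_le_sub_one_of_pos hx0]
  have := hanti ⟨ht0, ht1⟩ ⟨one_pos, le_rfl⟩ ht1
  norm_num at this
  linarith

/-- The lower matrix Chernoff bound for a sum of independent identically distributed rank-one
matrices: outside an event of small probability the sum is at least `t` times its mean. -/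
theorem exists_measurableSet_le_sum_sq_dotProduct [Nonempty n] (hφ : Measurable φ) (hL0 : 0 < L)
    (hL : ∀ᵐ p ∂ν, φ p ⬝ᵥ φ p ≤ L) (hlam0 : 0 < lam)
    (hlam : ∀ v : n → ℝ, lam * (v ⬝ᵥ v) ≤ ∫ p, (φ p ⬝ᵥ v) ^ 2 ∂ν)
    {t : ℝ} (ht0 : 0 < t) (ht1 : t < 1) (N : ℕ) :
    ∃ F : Set (Fin N → E), MeasurableSet F ∧
      (Measure.pi fun _ : Fin N => ν) Fᶜ ≤
        ENNReal.ofReal (Fintype.card n * Real.exp (-((1 - t) ^ 2 * N * lam / (2 * L)))) ∧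
      ∀ p ∈ F, ∀ v : n → ℝ, t * N * lam * (v ⬝ᵥ v) ≤ ∑ i, (φ (p i) ⬝ᵥ v) ^ 2 := by
  -- This s, with exp (-sL) = t, minimizes the exponent s t N lam - N (1 - exp (-sL)) lam / L.
  set s : ℝ := -Real.log t / L with hs
  have hs0 : 0 < s := div_pos (neg_pos.2 (Real.log_neg ht0 ht1)) hL0
  have hm := measurable_trace_exp_sum hφ (ι := Fin N) (-s)
  -- The event is cut out by the trace instead of the eigenvalues: it is plainly measurable, and
  -- Markov's inequality bounds its complement.
  refine ⟨{p | (NormedSpace.exp (∑ i, -s • vecMulVec (φ (p i)) (φ (p i)))).trace <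
    Real.exp (-(s * (t * N * lam)))}, measurableSet_lt hm measurable_const, ?_, ?_⟩
  · have hset : {p : Fin N → E | (NormedSpace.exp (∑ i, -s • vecMulVec (φ (p i)) (φ (p i)))).trace <
        Real.exp (-(s * (t * N * lam)))}ᶜ ⊆ {p | ENNReal.ofReal (Real.exp (-(s * (t * N * lam)))) ≤
        ENNReal.ofReal (NormedSpace.exp (∑ i, -s • vecMulVec (φ (p i)) (φ (p i)))).trace} :=
      fun p hp => ENNReal.ofReal_le_ofReal (not_lt.1 hp)
    refine (measure_mono hset).trans ((meas_ge_le_lintegral_div hm.ennreal_ofReal.aemeasurable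
      (by simp [Real.exp_pos]) ENNReal.ofReal_ne_top).trans ?_)
    refine (ENNReal.div_le_div_right (lintegral_trace_exp_sum_le hφ hL0 hL hlam hs0.le N) _).trans ?_
    rw [← ENNReal.ofReal_pow (Real.exp_pos _).le, ← ENNReal.ofReal_natCast (Fintype.card n),
      ← ENNReal.ofReal_mul (by positivity), ← ENNReal.ofReal_div_of_pos (Real.exp_pos _)]
    apply ENNReal.ofReal_le_ofReal
    rw [mul_comm, mul_div_assoc, ← Real.exp_nat_mul, ← Real.exp_sub]
    gcongr
    have h1 : -s * L = Real.log t := by rw [hs]; field_simp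
    rw [h1, Real.exp_log ht0]
    have h2 := half_sq_one_sub_le ht0 ht1.le
    have h3 : (N : ℝ) * -((1 - t) / L * lam) - -(s * (t * N * lam)) =
        -((t * Real.log t - t + 1) * (N * lam / L)) := by rw [hs]; field_simp; ring
    rw [h3]
    have h4 : (1 - t) ^ 2 * N * lam / (2 * L) = (1 - t) ^ 2 / 2 * (N * lam / L) := by field_simp
    rw [h4]
    gcongr
  · intro p hp v
    have hH := isHermitian_iff_isSymm.2 (isSymm_sum_smul_vecMulVec (-s) fun i => φ (p i))
    have h := hH.dotProduct_mulVec_le_of_trace_exp_le (le_of_lt hp) v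
    have h1 : v ⬝ᵥ (∑ i, -s • vecMulVec (φ (p i)) (φ (p i))) *ᵥ v =
        -s * ∑ i, (φ (p i) ⬝ᵥ v) ^ 2 := by
      rw [sum_mulVec, dotProduct_sum, Finset.mul_sum]
      refine Finset.sum_congr rfl fun i _ => ?_
      rw [smul_mulVec, vecMulVec_mulVec, dotProduct_smul, op_smul_eq_smul, dotProduct_smul,
        dotProduct_comm v, smul_eq_mul, smul_eq_mul]
      ring
    rw [h1] at h
    nlinarith

end Chernoff

end Matrix

namespace EDMCoherence

open Matrix

/-! ### Existence of compact singular value decompositions of symmetric matrices -/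

theorem _root_.Matrix.IsHermitian.apply_eq_sum {n : Type*} [Fintype n] [DecidableEq n]
    {A : Matrix n n ℝ} (hA : A.IsHermitian) (i j : n) :
    A i j = ∑ k, hA.eigenvalues k * (hA.eigenvectorBasis k i * hA.eigenvectorBasis k j) := by
  have h := hA.spectral_theorem
  rw [Unitary.conjStarAlgAut_apply] at h
  nth_rewrite 1 [h]
  rw [mul_apply]
  simp only [mul_diagonal, star_apply, IsHermitian.eigenvectorUnitary_apply, Function.comp_apply,
    RCLike.ofReal_real_eq_id, id, star_trivial]
  exact Finset.sum_congr rfl fun k _ => by ring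

/-- Keep the eigenvectors with nonzero eigenvalue, take absolute values, and put the signs into v.
This shows that the statement about every decomposition is not vacuous. -/
theorem nonempty_compactSVD_of_isHermitian {N : ℕ} {M : Matrix (Fin N) (Fin N) ℝ}
    (hM : M.IsHermitian) : Nonempty (CompactSVD M) := by
  have hcard : Fintype.card (Fin M.rank) = Fintype.card {i // hM.eigenvalues i ≠ 0} := by
    rw [Fintype.card_fin, hM.rank_eq_card_non_zero_eigs]
  let e := Fintype.equivOfCardEq hcard
  have ho : Orthonormal ℝ fun k => hM.eigenvectorBasis (e k) :=
    hM.eigenvectorBasis.orthonormal.comp _ (Subtype.val_injective.comp e.injective)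
  refine ⟨⟨fun k => hM.eigenvectorBasis (e k),
    fun k => (SignType.sign (hM.eigenvalues (e k)) : ℝ) • hM.eigenvectorBasis (e k),
    fun k => |hM.eigenvalues (e k)|, ho, ⟨fun k => ?_, fun k l hkl => ?_⟩,
    fun k => abs_pos.2 (e k).2, fun i j => ?_⟩⟩
  · rw [norm_smul, ho.1, mul_one]
    rcases lt_or_gt_of_ne (e k).2 with h | h
    · rw [sign_neg h]; simp
    · rw [sign_pos h]; simp
  · change inner ℝ _ _ = 0
    rw [inner_smul_left, inner_smul_right, ho.2 hkl]
    simp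
  · rw [hM.apply_eq_sum]
    have h1 : ∀ k, hM.eigenvalues k * (hM.eigenvectorBasis k i * hM.eigenvectorBasis k j) ≠ 0 →
        hM.eigenvalues k ≠ 0 := fun k => left_ne_zero_of_mul
    rw [← Finset.sum_filter_of_ne fun k _ => h1 k, ← Finset.sum_subtype_eq_sum_filter,
      Finset.subtype_univ, ← e.sum_comp]
    refine Finset.sum_congr rfl fun k _ => ?_
    simp only [PiLp.smul_apply, smul_eq_mul]
    linear_combination (-(hM.eigenvectorBasis (e k) i * hM.eigenvectorBasis (e k) j)) *
      sign_mul_abs (hM.eigenvalues (e k))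

/-! ### Coherence bounds from a pointwise bound on the column space -/

/-- The projection p of eᵢ has pᵢ = ‖p‖², so the pointwise bound at p reads ‖p‖⁴ ≤ β‖p‖². -/
theorem norm_starProjection_single_sq_le {N : ℕ} {U : Submodule ℝ (EuclideanSpace ℝ (Fin N))}
    {β : ℝ} (hβ : 0 ≤ β) (hU : ∀ u ∈ U, ∀ i, u i ^ 2 ≤ β * ‖u‖ ^ 2) (i : Fin N) :
    ‖U.starProjection (EuclideanSpace.single i (1 : ℝ))‖ ^ 2 ≤ β := by
  set p := U.starProjection (EuclideanSpace.single i (1 : ℝ)) with hp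
  have hmem : p ∈ U := U.starProjection_apply_mem _
  have h1 : p i = ‖p‖ ^ 2 := by
    have h2 : inner ℝ (EuclideanSpace.single i (1 : ℝ) - p) p = 0 :=
      U.starProjection_inner_eq_zero _ _ hmem
    rw [inner_sub_left, EuclideanSpace.inner_single_left, real_inner_self_eq_norm_sq] at h2
    simp at h2
    linarith
  have h3 := hU p hmem i
  rw [h1] at h3
  rcases (sq_nonneg ‖p‖).eq_or_lt with h | h
  · rw [← h]; exact hβ
  · nlinarith

theorem coherence_le {N : ℕ} {U : Submodule ℝ (EuclideanSpace ℝ (Fin N))}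
    {β : ℝ} (hβ : 0 ≤ β) (hU : ∀ u ∈ U, ∀ i, u i ^ 2 ≤ β * ‖u‖ ^ 2) :
    coherence U ≤ (N : ℝ) / (Module.finrank ℝ U : ℝ) * β :=
  mul_le_mul_of_nonneg_left (Real.iSup_le (norm_starProjection_single_sq_le hβ hU) hβ)
    (by positivity)

theorem sum_sq_apply_le {N : ℕ} {ι : Type*} [Fintype ι] {u : ι → EuclideanSpace ℝ (Fin N)}
    (hu : Orthonormal ℝ u) {β : ℝ} (hβ : 0 ≤ β)
    (hU : ∀ w ∈ Submodule.span ℝ (Set.range u), ∀ i, w i ^ 2 ≤ β * ‖w‖ ^ 2) (i : Fin N) :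
    ∑ k, u k i ^ 2 ≤ β := by
  -- This is the projection of eᵢ onto the span: its i-th entry and its squared norm are both the
  -- sum in question.
  set w := ∑ k, u k i • u k with hw
  have hmem : w ∈ Submodule.span ℝ (Set.range u) :=
    Submodule.sum_mem _ fun k _ => Submodule.smul_mem _ _ (Submodule.subset_span ⟨k, rfl⟩)
  have h1 : w i = ∑ k, u k i ^ 2 := by
    simp [hw, sq]
  have h2 : ‖w‖ ^ 2 = ∑ k, u k i ^ 2 := by
    rw [← real_inner_self_eq_norm_sq, hw, hu.inner_sum]
    simp [sq]
  have h3 := hU w hmem i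
  rw [h1, h2] at h3
  have h0 : 0 ≤ ∑ k, u k i ^ 2 := by positivity
  rcases h0.eq_or_lt with h | h
  · rw [← h]; exact hβ
  · nlinarith

namespace CompactSVD

variable {K L : ℕ} {M : Matrix (Fin K) (Fin L) ℝ} (S : CompactSVD M)

theorem u_apply (k : Fin M.rank) (i : Fin K) :
    S.u k i = (M *ᵥ fun j => (S.σ k)⁻¹ * S.v k j) i := by
  have hv : ∀ l, ∑ j, S.v l j * S.v k j = if l = k then 1 else 0 := fun l => by
    rw [← orthonormal_iff_ite.1 S.orthonormal_v l k]
    simp [PiLp.inner_apply, mul_comm]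
  have h1 : ∀ j, M i j * ((S.σ k)⁻¹ * S.v k j) =
      ∑ l, (S.σ k)⁻¹ * (S.σ l * S.u l i) * (S.v l j * S.v k j) := fun j => by
    rw [S.eq_sum, Finset.sum_mul]
    exact Finset.sum_congr rfl fun l _ => by ring
  simp only [mulVec, dotProduct, h1]
  rw [Finset.sum_comm]
  simp only [← Finset.mul_sum, hv]
  have := (S.σ_pos k).ne'
  simp only [mul_ite, mul_one, mul_zero, Finset.sum_ite_eq', Finset.mem_univ, if_true]
  field_simp

theorem v_apply (k : Fin M.rank) (j : Fin L) :
    S.v k j = (Mᵀ *ᵥ fun i => (S.σ k)⁻¹ * S.u k i) j := by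
  have hv : ∀ l, ∑ j, S.u l j * S.u k j = if l = k then 1 else 0 := fun l => by
    rw [← orthonormal_iff_ite.1 S.orthonormal_u l k]
    simp [PiLp.inner_apply, mul_comm]
  have h1 : ∀ i, Mᵀ j i * ((S.σ k)⁻¹ * S.u k i) =
      ∑ l, (S.σ k)⁻¹ * (S.σ l * S.v l j) * (S.u l i * S.u k i) := fun i => by
    rw [transpose_apply, S.eq_sum, Finset.sum_mul]
    exact Finset.sum_congr rfl fun l _ => by ring
  simp only [mulVec, dotProduct, h1]
  rw [Finset.sum_comm]
  simp only [← Finset.mul_sum, hv]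
  have := (S.σ_pos k).ne'
  simp only [mul_ite, mul_one, mul_zero, Finset.sum_ite_eq', Finset.mem_univ, if_true]
  field_simp

/-- Each uₖ is M applied to σₖ⁻¹ vₖ. Inclusion suffices, because the pointwise bound is proved on
the whole range. -/
theorem colSpace_le_range :
    S.colSpace ≤ LinearMap.range (toEuclideanLin M) := by
  refine Submodule.span_le.2 ?_
  rintro _ ⟨k, rfl⟩
  refine ⟨WithLp.toLp 2 fun j => (S.σ k)⁻¹ * S.v k j, ?_⟩
  ext i
  rw [S.u_apply]
  rfl

theorem rowSpace_le_range :
    S.rowSpace ≤ LinearMap.range (toEuclideanLin Mᵀ) := by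
  refine Submodule.span_le.2 ?_
  rintro _ ⟨k, rfl⟩
  refine ⟨WithLp.toLp 2 fun j => (S.σ k)⁻¹ * S.u k j, ?_⟩
  ext i
  rw [S.v_apply]
  rfl

theorem abs_sum_mul_le {β : ℝ} (hβ : 0 ≤ β)
    (hU : ∀ w ∈ S.colSpace, ∀ i, w i ^ 2 ≤ β * ‖w‖ ^ 2)
    (hV : ∀ w ∈ S.rowSpace, ∀ i, w i ^ 2 ≤ β * ‖w‖ ^ 2) (i : Fin K) (j : Fin L) :
    |∑ k, S.u k i * S.v k j| ≤ β := by
  refine abs_le_of_sq_le_sq ?_ hβ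
  refine (Finset.sum_mul_sq_le_sq_mul_sq _ _ _).trans ?_
  rw [sq]
  exact mul_le_mul (sum_sq_apply_le S.orthonormal_u hβ hU i)
    (sum_sq_apply_le S.orthonormal_v hβ hV j) (by positivity) hβ

theorem coherence_colSpace_le {β : ℝ} (hβ : 0 ≤ β)
    (hU : ∀ w ∈ S.colSpace, ∀ i, w i ^ 2 ≤ β * ‖w‖ ^ 2) :
    coherence S.colSpace ≤ K / M.rank * β := by
  have h := coherence_le hβ hU
  rwa [colSpace, finrank_span_eq_card S.orthonormal_u.linearIndependent, Fintype.card_fin] at h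

theorem coherence_rowSpace_le {β : ℝ} (hβ : 0 ≤ β)
    (hV : ∀ w ∈ S.rowSpace, ∀ i, w i ^ 2 ≤ β * ‖w‖ ^ 2) :
    coherence S.rowSpace ≤ L / M.rank * β := by
  have h := coherence_le hβ hV
  rwa [rowSpace, finrank_span_eq_card S.orthonormal_v.linearIndependent, Fintype.card_fin] at h

end CompactSVD

/-! ### Euclidean distance matrices through lifted rows -/

section Lift

variable {N d : ℕ}

/-- The matrix with rows `(1, pᵢ, ‖pᵢ‖²)`. -/
def liftedMatrix (p : Fin N → Fin d → ℝ) : Matrix (Fin N) (Unit ⊕ Fin d ⊕ Unit) ℝ :=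
  Matrix.of fun i => liftedRow (p i)

/-- The matrix of the bilinear form `u₀ v∞ + u∞ v₀ - 2 ∑ uⱼ vⱼ`. -/
def liftedForm (d : ℕ) : Matrix (Unit ⊕ Fin d ⊕ Unit) (Unit ⊕ Fin d ⊕ Unit) ℝ :=
  Matrix.of fun k => Sum.elim (fun _ => Sum.elim 0 (Sum.elim 0 1))
    (Sum.elim (fun j => Sum.elim 0 (Sum.elim (Pi.single j (-2)) 0)) fun _ => Sum.elim 1 0) k

/-- The inverse of `liftedForm`. -/
noncomputable def liftedFormInv (d : ℕ) : Matrix (Unit ⊕ Fin d ⊕ Unit) (Unit ⊕ Fin d ⊕ Unit) ℝ :=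
  Matrix.of fun k => Sum.elim (fun _ => Sum.elim 0 (Sum.elim 0 1))
    (Sum.elim (fun j => Sum.elim 0 (Sum.elim (Pi.single j (-2)⁻¹) 0)) fun _ => Sum.elim 1 0) k

theorem liftedForm_mul_inv (d : ℕ) : liftedForm d * liftedFormInv d = 1 := by
  ext k l
  rw [mul_apply]
  rcases k with _ | k | _ <;> rcases l with _ | l | _ <;>
    simp [liftedForm, liftedFormInv, one_apply, Pi.single_apply, Fintype.sum_sum_type, eq_comm]
  split_ifs <;> simp

theorem edm_eq (p : Fin N → Fin d → ℝ) :
    edm (fun i => WithLp.toLp 2 (p i)) =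
      liftedMatrix p * liftedForm d * (liftedMatrix p)ᵀ := by
  ext i j
  have h : dist (WithLp.toLp 2 (p i)) (WithLp.toLp 2 (p j)) ^ 2 = ∑ k, (p i k - p j k) ^ 2 := by
    rw [EuclideanSpace.dist_eq, Real.sq_sqrt (by positivity)]
    simp [Real.dist_eq]
  simp only [edm, of_apply, h, mul_apply, transpose_apply, Fintype.sum_sum_type]
  simp [liftedMatrix, liftedForm, liftedRow, Pi.single_apply]
  simp only [sub_sq, Finset.sum_add_distrib, Finset.sum_sub_distrib, mul_assoc]
  have h1 : ∑ k, 2 * (p i k * p j k) = ∑ k, p i k * (2 * p j k) :=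
    Finset.sum_congr rfl fun k _ => by ring
  linarith

theorem edm_isSymm (p : Fin N → EuclideanSpace ℝ (Fin d)) : (edm p).IsSymm := by
  ext i j
  simp [edm, dist_comm]

variable {p : Fin N → Fin d → ℝ} {lam : ℝ}

theorem rank_edm (hlam : 0 < lam)
    (h : ∀ v, lam * (v ⬝ᵥ v) ≤ ∑ i, (liftedRow (p i) ⬝ᵥ v) ^ 2) :
    (edm (fun i => WithLp.toLp 2 (p i))).rank = d + 2 := by
  set X := liftedMatrix p with hX
  have hker : ∀ v, X *ᵥ v = 0 → v = 0 := fun v hv => by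
    have h1 := h v
    have h2 : ∑ i, (liftedRow (p i) ⬝ᵥ v) ^ 2 = 0 :=
      Finset.sum_eq_zero fun i _ => by
        have : liftedRow (p i) ⬝ᵥ v = 0 := congrFun hv i
        rw [this]; simp
    have h0 : 0 ≤ v ⬝ᵥ v := by simpa using dotProduct_star_self_nonneg v
    have h3 : v ⬝ᵥ v = 0 := by nlinarith
    simpa using h3
  have hunit : IsUnit (Xᵀ * X) := by
    rw [← mulVec_injective_iff_isUnit, ← coe_mulVecLin, ← LinearMap.ker_eq_bot, LinearMap.ker_eq_bot']
    intro v hv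
    refine hker v ?_
    have h1 : (X *ᵥ v) ⬝ᵥ (X *ᵥ v) = 0 := by
      rw [dotProduct_mulVec, ← mulVec_transpose, mulVec_mulVec]
      rw [mulVecLin_apply] at hv
      rw [hv, zero_dotProduct]
    simpa using h1
  have hA : IsUnit (liftedForm d) := IsUnit.of_mul_eq_one _ (liftedForm_mul_inv d)
  have hcard : Fintype.card (Unit ⊕ Fin d ⊕ Unit) = d + 2 := by
    simp; ring
  rw [edm_eq]
  refine le_antisymm ?_ ?_
  · rw [Matrix.mul_assoc, ← hcard]
    exact (rank_mul_le_left _ _).trans (rank_le_card_width _)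
  -- This compression of Δ is invertible of size d + 2, which forces the rank of Δ up to d + 2.
  · have h1 : Xᵀ * (X * liftedForm d * Xᵀ) * X = (Xᵀ * X) * liftedForm d * (Xᵀ * X) := by
      simp only [Matrix.mul_assoc]
    rw [← hcard, ← rank_of_isUnit _ ((hunit.mul hA).mul hunit), ← h1]
    exact (rank_mul_le_left _ _).trans (rank_mul_le_right _ _)

theorem sq_apply_le_of_mem_range (hlam : 0 < lam)
    (h : ∀ v, lam * (v ⬝ᵥ v) ≤ ∑ i, (liftedRow (p i) ⬝ᵥ v) ^ 2) {B : ℝ}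
    (hB : ∀ i, liftedRow (p i) ⬝ᵥ liftedRow (p i) ≤ B) {w : EuclideanSpace ℝ (Fin N)}
    (hw : w ∈ LinearMap.range (toEuclideanLin (edm (fun i => WithLp.toLp 2 (p i))))) (i : Fin N) :
    w i ^ 2 ≤ B / lam * ‖w‖ ^ 2 := by
  obtain ⟨c, rfl⟩ := hw
  rw [edm_eq]
  set v := liftedForm d *ᵥ ((liftedMatrix p)ᵀ *ᵥ c.ofLp) with hv
  have h1 : ∀ j, (toEuclideanLin (liftedMatrix p * liftedForm d * (liftedMatrix p)ᵀ) c) j =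
      liftedRow (p j) ⬝ᵥ v := fun j => by
    rw [toLpLin_apply]
    simp only [← mulVec_mulVec]
    rfl
  have h2 : 0 ≤ v ⬝ᵥ v := by simpa using dotProduct_star_self_nonneg v
  rw [EuclideanSpace.norm_sq_eq]
  simp only [h1, Real.norm_eq_abs, sq_abs]
  refine (sq_dotProduct_le _ _).trans ?_
  have h3 : 0 ≤ B := le_trans (Finset.sum_nonneg fun _ _ => mul_self_nonneg _) (hB i)
  calc _ ≤ B * (v ⬝ᵥ v) := mul_le_mul_of_nonneg_right (hB i) h2
    _ = B / lam * (lam * (v ⬝ᵥ v)) := by field_simp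
    _ ≤ _ := mul_le_mul_of_nonneg_left (h v) (by positivity)

theorem edm_coherence (hN : 0 < N) (hlam : 0 < lam)
    (h : ∀ v, lam * (v ⬝ᵥ v) ≤ ∑ i, (liftedRow (p i) ⬝ᵥ v) ^ 2) {B : ℝ} (hB0 : 0 < B)
    (hB : ∀ i, liftedRow (p i) ⬝ᵥ liftedRow (p i) ≤ B)
    (S : CompactSVD (edm (fun i => WithLp.toLp 2 (p i)))) :
    S.A0 (N * (B / lam) / (d + 2)) ∧ S.A1 (N * (B / lam) / √(d + 2)) := by
  have hN' : (0 : ℝ) < N := by exact_mod_cast hN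
  have hβ : 0 ≤ B / lam := by positivity
  have hU : ∀ w ∈ S.colSpace, ∀ i, w i ^ 2 ≤ B / lam * ‖w‖ ^ 2 := fun w hw =>
    sq_apply_le_of_mem_range hlam h hB (S.colSpace_le_range hw)
  have hV : ∀ w ∈ S.rowSpace, ∀ i, w i ^ 2 ≤ B / lam * ‖w‖ ^ 2 := fun w hw =>
    sq_apply_le_of_mem_range hlam h hB
      (by simpa only [(edm_isSymm _).eq] using S.rowSpace_le_range hw)
  have hr : ((edm (fun i => WithLp.toLp 2 (p i))).rank : ℝ) = d + 2 := by
    rw [rank_edm hlam h]; push_cast; ring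
  refine ⟨⟨by positivity, max_le ?_ ?_⟩, by positivity, fun i j => ?_⟩
  · refine (S.coherence_colSpace_le hβ hU).trans_eq ?_
    rw [hr]; ring
  · refine (S.coherence_rowSpace_le hβ hV).trans_eq ?_
    rw [hr]; ring
  · refine (S.abs_sum_mul_le hβ hU hV i j).trans_eq ?_
    rw [hr, Real.sqrt_div (by positivity), Real.sqrt_mul_self hN'.le]
    have : √((d : ℝ) + 2) ≠ 0 := by positivity
    field_simp

end Lift

end EDMCoherence

namespace EDMCoherence

open Matrix

/-! ### Moments of a bounded law -/

section Moments

variable {P : Measure ℝ} [IsProbabilityMeasure P] {a b : ℝ}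

theorem ae_pi_mem_Icc (hsupp : ∀ᵐ x ∂P, x ∈ Set.Icc a b) (d : ℕ) :
    ∀ᵐ p ∂(Measure.pi fun _ : Fin d => P), p ∈ Set.pi Set.univ fun _ => Set.Icc a b := by
  have h : ∀ j, ∀ᵐ p ∂(Measure.pi fun _ : Fin d => P), p j ∈ Set.Icc a b := fun j =>
    (Measure.quasiMeasurePreserving_eval (fun _ : Fin d => P) j).ae hsupp
  filter_upwards [ae_all_iff.2 h] with p hp j _
  exact hp j

theorem integrable_pi_of_continuous (hsupp : ∀ᵐ x ∂P, x ∈ Set.Icc a b) {d : ℕ}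
    {g : (Fin d → ℝ) → ℝ} (hg : Continuous g) : Integrable g (Measure.pi fun _ : Fin d => P) := by
  obtain ⟨B, hB⟩ := (isCompact_univ_pi fun _ : Fin d => isCompact_Icc (a := a) (b := b)).exists_bound_of_continuousOn
    hg.continuousOn
  exact Integrable.of_bound hg.aestronglyMeasurable B
    ((ae_pi_mem_Icc hsupp d).mono fun p hp => hB p hp)

theorem integrable_of_continuous (hsupp : ∀ᵐ x ∂P, x ∈ Set.Icc a b)
    {g : ℝ → ℝ} (hg : Continuous g) : Integrable g P := by
  obtain ⟨B, hB⟩ := (isCompact_Icc (a := a) (b := b)).exists_bound_of_continuousOn hg.continuousOn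
  exact Integrable.of_bound hg.aestronglyMeasurable B (hsupp.mono fun p hp => hB p hp)

/-- An atomless law does not charge the finite zero set of a nonzero polynomial. -/
theorem integral_sq_eval_pos [NullSingletonClass P] (hsupp : ∀ᵐ x ∂P, x ∈ Set.Icc a b)
    {q : ℝ[X]} (hq : q ≠ 0) : 0 < ∫ x, q.eval x ^ 2 ∂P := by
  have hint : Integrable (fun x => q.eval x ^ 2) P :=
    integrable_of_continuous hsupp (q.continuous.pow 2)
  refine lt_of_le_of_ne (integral_nonneg fun x => sq_nonneg _) fun h => ?_
  have h0 := (integral_eq_zero_iff_of_nonneg (fun x => sq_nonneg _) hint).1 h.symm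
  have hroots : P {x | q.eval x = 0} = 0 := by
    refine Set.Finite.measure_zero ?_ P
    refine (q.roots.toFinset.finite_toSet).subset fun x hx => ?_
    simpa [hq] using hx
  have hne : ∀ᵐ x ∂P, q.eval x ≠ 0 := by
    rw [ae_iff]; simpa using hroots
  obtain ⟨x, h1, h2⟩ := (h0.and hne).exists
  exact h2 (by simpa using h1)

theorem mom_two_pos [NullSingletonClass P] (hsupp : ∀ᵐ x ∂P, x ∈ Set.Icc a b) : 0 < mom P 2 := by
  simpa [mom] using integral_sq_eval_pos hsupp (X_ne_zero (R := ℝ))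

theorem mom_gram_pos [NullSingletonClass P] (hsupp : ∀ᵐ x ∂P, x ∈ Set.Icc a b)
    (hmean : mom P 1 = 0) : 0 < mom P 4 - mom P 2 ^ 2 - mom P 3 ^ 2 / mom P 2 := by
  have h2 := mom_two_pos hsupp
  set r := mom P 3 / mom P 2 with hr
  -- This is x² minus its L²(P) projection onto the span of 1 and x; the claimed quantity is its
  -- squared norm.
  have hq : (X ^ 2 - C r * X - C (mom P 2) : ℝ[X]) ≠ 0 := by
    intro h
    have := congrArg (fun q : ℝ[X] => q.coeff 2) h
    simp at this
  have hpos := integral_sq_eval_pos hsupp hq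
  have hi : ∀ k : ℕ, Integrable (fun x : ℝ => x ^ k) P := fun k =>
    integrable_of_continuous hsupp (continuous_pow k)
  have hexp : ∀ x : ℝ, (X ^ 2 - C r * X - C (mom P 2) : ℝ[X]).eval x ^ 2 =
      x ^ 4 + -(2 * r) * x ^ 3 + (r ^ 2 - 2 * mom P 2) * x ^ 2 + 2 * r * mom P 2 * x ^ 1 +
        mom P 2 ^ 2 := fun x => by
    simp; ring
  simp only [hexp] at hpos
  rw [integral_add (by fun_prop) (by fun_prop), integral_add (by fun_prop) (by fun_prop),
    integral_add (by fun_prop) (by fun_prop), integral_add (by fun_prop) (by fun_prop)] at hpos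
  simp only [integral_const_mul, integral_const, probReal_univ, one_smul] at hpos
  change 0 < mom P 4 + -(2 * r) * mom P 3 + (r ^ 2 - 2 * mom P 2) * mom P 2 +
    2 * r * mom P 2 * mom P 1 + mom P 2 ^ 2 at hpos
  have h3 : mom P 3 = r * mom P 2 := by rw [hr]; field_simp
  rw [hmean, h3] at hpos
  rw [h3]
  have h4 : (r * mom P 2) ^ 2 / mom P 2 = r ^ 2 * mom P 2 := by field_simp
  rw [h4]
  linarith

theorem integral_pi_pow (d : ℕ) (i : Fin d) (k : ℕ) :
    ∫ p, p i ^ k ∂(Measure.pi fun _ : Fin d => P) = mom P k :=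
  integral_comp_eval (μ := fun _ : Fin d => P) (f := fun x => x ^ k)
    (continuous_pow k).aestronglyMeasurable

theorem integral_pi_pow_mul_pow {d : ℕ} {i j : Fin d} (hij : i ≠ j) (k l : ℕ) :
    ∫ p, p i ^ k * p j ^ l ∂(Measure.pi fun _ : Fin d => P) = mom P k * mom P l := by
  have h := iIndepFun_pi (μ := fun _ : Fin d => P) (X := fun _ x => x) fun _ => aemeasurable_id
  have h2 := (h.indepFun hij).comp (measurable_id.pow_const k) (measurable_id.pow_const l)
  have h3 := h2.integral_fun_mul_eq_mul_integral
    ((measurable_id.pow_const k).comp (measurable_pi_apply i)).aestronglyMeasurable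
    ((measurable_id.pow_const l).comp (measurable_pi_apply j)).aestronglyMeasurable
  rw [← integral_pi_pow d i k, ← integral_pi_pow d j l]
  exact h3

end Moments

/-! ### The second-moment matrix -/

section SecondMoment

variable {P : Measure ℝ} {a b : ℝ} {d : ℕ}

theorem continuous_liftedRow : Continuous (liftedRow (d := d)) := by
  refine continuous_pi fun k => ?_
  rcases k with _ | k | _ <;> simp only [liftedRow, Sum.elim_inl, Sum.elim_inr] <;> fun_prop

/-- The second moment of `‖p‖²`. -/
noncomputable def quarticMoment (P : Measure ℝ) (d : ℕ) : ℝ :=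
  d * mom P 4 + d * (d - 1) * mom P 2 ^ 2

theorem secondMoment_isHermitian : (secondMoment P d).IsHermitian := by
  rw [isHermitian_iff_isSymm]
  ext k l
  simp [secondMoment, mul_comm]

theorem dotProduct_secondMoment_mulVec [IsProbabilityMeasure P] (hsupp : ∀ᵐ x ∂P, x ∈ Set.Icc a b)
    (v : Unit ⊕ Fin d ⊕ Unit → ℝ) :
    v ⬝ᵥ secondMoment P d *ᵥ v =
      ∫ p, (liftedRow p ⬝ᵥ v) ^ 2 ∂(Measure.pi fun _ : Fin d => P) := by
  have hc : ∀ k, Continuous fun p : Fin d → ℝ => liftedRow p k := fun k =>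
    (continuous_apply k).comp continuous_liftedRow
  have h1 : ∀ p : Fin d → ℝ, (liftedRow p ⬝ᵥ v) ^ 2 =
      ∑ k, ∑ l, v k * v l * (liftedRow p k * liftedRow p l) := fun p => by
    rw [sq, dotProduct, Finset.sum_mul_sum]
    exact Finset.sum_congr rfl fun k _ => Finset.sum_congr rfl fun l _ => by ring
  have hint : ∀ k l, Integrable (fun p => v k * v l * (liftedRow p k * liftedRow p l))
      (Measure.pi fun _ : Fin d => P) := fun k l =>
    integrable_pi_of_continuous hsupp (continuous_const.mul ((hc k).mul (hc l)))
  simp only [h1]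
  rw [integral_finsetSum _ fun k _ => integrable_finsetSum _ fun l _ => hint k l]
  simp only [dotProduct, mulVec, Finset.mul_sum]
  refine Finset.sum_congr rfl fun k _ => ?_
  rw [integral_finsetSum _ fun l _ => hint k l]
  refine Finset.sum_congr rfl fun l _ => ?_
  rw [integral_const_mul, secondMoment, of_apply]
  ring

theorem secondMoment_mulVec [IsProbabilityMeasure P] (hsupp : ∀ᵐ x ∂P, x ∈ Set.Icc a b) (hmean : mom P 1 = 0)
    (v : Unit ⊕ Fin d ⊕ Unit → ℝ) :
    secondMoment P d *ᵥ v = Sum.elim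
      (fun _ => v (.inl ()) + d * mom P 2 * v (.inr (.inr ())))
      (Sum.elim (fun i => mom P 2 * v (.inr (.inl i)) + mom P 3 * v (.inr (.inr ())))
        fun _ => d * mom P 2 * v (.inl ()) + mom P 3 * ∑ i, v (.inr (.inl i)) +
          quarticMoment P d * v (.inr (.inr ()))) := by
  set ν := Measure.pi fun _ : Fin d => P with hν
  have hi : ∀ g : (Fin d → ℝ) → ℝ, Continuous g → Integrable g ν := fun g hg =>
    integrable_pi_of_continuous hsupp hg
  have m1 : ∀ i, ∫ p, p i ∂ν = 0 := fun i => by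
    have := integral_pi_pow (P := P) d i 1
    simpa [hmean] using this
  have m2 : ∫ p, ∑ j, p j ^ 2 ∂ν = d * mom P 2 := by
    rw [integral_finsetSum _ fun j _ => hi _ (by fun_prop)]
    simp [hν, integral_pi_pow]
  have m11 : ∀ i j, ∫ p, p i * p j ∂ν = if i = j then mom P 2 else 0 := fun i j => by
    split_ifs with h
    · subst h
      simp only [← sq]
      exact integral_pi_pow d i 2
    · have := integral_pi_pow_mul_pow (P := P) h 1 1
      simpa [hmean] using this
  have m12 : ∀ i, ∫ p, p i * ∑ j, p j ^ 2 ∂ν = mom P 3 := fun i => by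
    simp only [Finset.mul_sum]
    rw [integral_finsetSum _ fun j _ => hi _ (by fun_prop), Finset.sum_eq_single i]
    · simp only [← pow_succ']
      exact integral_pi_pow d i 3
    · intro j _ hj
      have := integral_pi_pow_mul_pow (P := P) (Ne.symm hj) 1 2
      simpa [hmean] using this
    · simp
  have m21 : ∀ i, ∫ p, (∑ j, p j ^ 2) * p i ∂ν = mom P 3 := fun i => by
    simpa only [mul_comm] using m12 i
  have m22 : ∫ p, (∑ j, p j ^ 2) * ∑ j, p j ^ 2 ∂ν = quarticMoment P d := by
    simp only [Finset.sum_mul_sum]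
    rw [integral_finsetSum _ fun j _ => hi _ (by fun_prop)]
    have h1 : ∀ i, ∫ p, ∑ j, p i ^ 2 * p j ^ 2 ∂ν = mom P 4 + (d - 1) * mom P 2 ^ 2 := fun i => by
      rw [integral_finsetSum _ fun j _ => hi _ (by fun_prop),
        ← Finset.add_sum_erase _ _ (Finset.mem_univ i)]
      have h2 : ∀ j ∈ Finset.univ.erase i, ∫ p, p i ^ 2 * p j ^ 2 ∂ν = mom P 2 ^ 2 := fun j hj => by
        rw [sq (mom P 2)]
        exact integral_pi_pow_mul_pow (Finset.ne_of_mem_erase hj).symm 2 2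
      rw [Finset.sum_congr rfl h2, Finset.sum_const, Finset.card_erase_of_mem (Finset.mem_univ i),
        Finset.card_univ, Fintype.card_fin, nsmul_eq_mul,
        Nat.cast_sub (Nat.one_le_iff_ne_zero.2 (Fin.pos i).ne')]
      simp only [← pow_add]
      rw [integral_pi_pow d i (2 + 2)]
      simp
    simp only [h1, Finset.sum_const, Finset.card_univ, Fintype.card_fin, nsmul_eq_mul,
      quarticMoment]
    ring
  funext k
  rw [mulVec, dotProduct]
  simp only [Fintype.sum_sum_type, Finset.univ_unique, Finset.sum_singleton, secondMoment, of_apply,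
    ← hν]
  rcases k with _ | k | _
  · simp [liftedRow, m1, m2]
  · simp [liftedRow, m1, m11, m12]
  · simp [liftedRow, m2, m22, m21, ← Finset.mul_sum]
    ring

/-- The symmetric matrix of the quadratic form of the second-moment matrix on the span of `1`,
`d ^ (-1/2) ∑ⱼ pⱼ` and `‖p‖²`. -/
noncomputable def reducedMoment (P : Measure ℝ) (d : ℕ) : Matrix (Fin 3) (Fin 3) ℝ :=
  !![1, 0, d * mom P 2; 0, mom P 2, √d * mom P 3; d * mom P 2, √d * mom P 3, quarticMoment P d]

theorem reducedMoment_mulVec (x : Fin 3 → ℝ) :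
    reducedMoment P d *ᵥ x = ![x 0 + d * mom P 2 * x 2, mom P 2 * x 1 + √d * mom P 3 * x 2,
      d * mom P 2 * x 0 + √d * mom P 3 * x 1 + quarticMoment P d * x 2] := by
  ext i
  fin_cases i <;> simp [reducedMoment, mulVec, dotProduct, Fin.sum_univ_three]

theorem reducedMoment_isHermitian : (reducedMoment P d).IsHermitian := by
  rw [isHermitian_iff_isSymm]
  ext i j
  fin_cases i <;> fin_cases j <;> simp [reducedMoment]

/-- Since the 3 × 3 matrix is symmetric, this yields three real roots with multiplicity; the sign
matches the leading coefficient -1. -/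
theorem cubic_eq_neg_charpoly : cubic P d = -(reducedMoment P d).charpoly := by
  refine Polynomial.funext fun r => ?_
  rw [eval_neg, eval_charpoly, det_fin_three]
  have h : √(d : ℝ) ^ 2 = d := Real.sq_sqrt (Nat.cast_nonneg d)
  simp [cubic, reducedMoment, α₀, α₁, α₂, α₃, quarticMoment]
  ring_nf
  simp only [h]
  ring

theorem roots_cubic : (cubic P d).roots =
    Finset.univ.val.map (reducedMoment_isHermitian (P := P) (d := d)).eigenvalues := by
  rw [cubic_eq_neg_charpoly, roots_neg,
    reducedMoment_isHermitian.roots_charpoly_eq_eigenvalues]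
  rfl

theorem mem_roots_cubic_iff {l : ℝ} : l ∈ (cubic P d).roots ↔
    ∃ x : Fin 3 → ℝ, x ≠ 0 ∧ reducedMoment P d *ᵥ x = l • x := by
  rw [cubic_eq_neg_charpoly, roots_neg, mem_roots (charpoly_monic _).ne_zero, IsRoot,
    eval_charpoly, ← exists_mulVec_eq_zero_iff]
  refine exists_congr fun x => and_congr_right fun _ => ?_
  rw [sub_mulVec, sub_eq_zero, scalar_apply, ← smul_one_eq_diagonal, smul_mulVec, one_mulVec, eq_comm]

theorem reducedMoment_posDef [IsProbabilityMeasure P] [NullSingletonClass P] (hd : 1 ≤ d)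
    (hsupp : ∀ᵐ x ∂P, x ∈ Set.Icc a b) (hmean : mom P 1 = 0) : (reducedMoment P d).PosDef := by
  refine PosDef.of_dotProduct_mulVec_pos reducedMoment_isHermitian fun x hx => ?_
  have h2 := mom_two_pos hsupp
  have hg := mom_gram_pos hsupp hmean
  have hd0 : (0 : ℝ) < d := by exact_mod_cast hd
  have hs : √(d : ℝ) ^ 2 = d := Real.sq_sqrt (Nat.cast_nonneg d)
  -- Complete squares in x 0 and x 1; the coefficient left on x 2 is d times the Gram quantity of
  -- `mom_gram_pos`.
  have key : star x ⬝ᵥ reducedMoment P d *ᵥ x = (x 0 + d * mom P 2 * x 2) ^ 2 +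
      mom P 2 * (x 1 + √d * mom P 3 / mom P 2 * x 2) ^ 2 +
      d * (mom P 4 - mom P 2 ^ 2 - mom P 3 ^ 2 / mom P 2) * x 2 ^ 2 := by
    rw [reducedMoment_mulVec]
    simp only [star_trivial, dotProduct, Fin.sum_univ_three, quarticMoment, cons_val]
    field_simp
    ring_nf
    simp only [hs]
    ring
  rw [key]
  generalize mom P 4 - mom P 2 ^ 2 - mom P 3 ^ 2 / mom P 2 = g at hg
  by_cases h3 : x 2 = 0
  · by_cases h1 : x 1 = 0
    · have h0 : x 0 ≠ 0 := fun h0 => hx (by ext i; fin_cases i <;> assumption)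
      simp only [h1, h3, mul_zero, add_zero]
      positivity
    · simp only [h3, mul_zero, add_zero]
      positivity
  · positivity

theorem roots_cubic_pos [IsProbabilityMeasure P] [NullSingletonClass P] (hd : 1 ≤ d)
    (hsupp : ∀ᵐ x ∂P, x ∈ Set.Icc a b) (hmean : mom P 1 = 0) :
    ∀ l ∈ (cubic P d).roots, 0 < l := by
  intro l hl
  rw [roots_cubic, Multiset.mem_map] at hl
  obtain ⟨i, _, rfl⟩ := hl
  exact (reducedMoment_posDef hd hsupp hmean).eigenvalues_pos i

theorem card_roots_cubic : (cubic P d).roots.card = 3 := by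
  simp [roots_cubic]

/-- The middle diagonal entry m₂ is a Rayleigh quotient of the 3 × 3 matrix. Hence m₂ never lowers
the minimum, and λ* is always a root. This matters for d = 1, where there are no nonzero sum-zero
vectors. -/
theorem exists_mem_roots_cubic_le : ∃ l ∈ (cubic P d).roots, l ≤ mom P 2 := by
  set hM := reducedMoment_isHermitian (P := P) (d := d)
  obtain ⟨i, hi⟩ := Finite.exists_min hM.eigenvalues
  refine ⟨hM.eigenvalues i, by rw [roots_cubic]; exact Multiset.mem_map_of_mem _ (Finset.mem_univ i), ?_⟩
  have h := hM.le_dotProduct_mulVec hi (Pi.single 1 1)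
  simpa [reducedMoment] using h

theorem lambdaStar_mem_roots : lambdaStar P d ∈ (cubic P d).roots := by
  obtain ⟨l, hl, hle⟩ := exists_mem_roots_cubic_le (P := P) (d := d)
  have h := Finset.min'_mem (insert (mom P 2) (cubic P d).roots.toFinset) (Finset.insert_nonempty _ _)
  rcases Finset.mem_insert.1 h with h | h
  · have h1 : lambdaStar P d ≤ l :=
      Finset.min'_le _ _ (Finset.mem_insert_of_mem (Multiset.mem_toFinset.2 hl))
    have h2 : lambdaStar P d = l := le_antisymm h1 (hle.trans h.ge)
    rwa [h2]
  · exact Multiset.mem_toFinset.1 h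

theorem hasEigenvalue_secondMoment_iff {l : ℝ} :
    Module.End.HasEigenvalue (toLin' (secondMoment P d)) l ↔
      ∃ v, v ≠ 0 ∧ secondMoment P d *ᵥ v = l • v := by
  constructor
  · intro h
    obtain ⟨v, hv⟩ := h.exists_hasEigenvector
    exact ⟨v, hv.2, by simpa using hv.apply_eq_smul⟩
  · rintro ⟨v, hv, h⟩
    exact Module.End.hasEigenvalue_of_hasEigenvector
      ⟨Module.End.mem_eigenspace_iff.2 (by simpa using h), hv⟩

theorem isLeast_lambdaStar [IsProbabilityMeasure P] (hd : 1 ≤ d) (hsupp : ∀ᵐ x ∂P, x ∈ Set.Icc a b)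
    (hmean : mom P 1 = 0) :
    IsLeast {l : ℝ | Module.End.HasEigenvalue (toLin' (secondMoment P d)) l} (lambdaStar P d) := by
  have hs : √(d : ℝ) * √d = d := Real.mul_self_sqrt (Nat.cast_nonneg d)
  have hs0 : √(d : ℝ) ≠ 0 := by
    have : (0 : ℝ) < d := by exact_mod_cast hd
    positivity
  constructor
  · obtain ⟨x, hx, hMx⟩ := mem_roots_cubic_iff.1 (lambdaStar_mem_roots (P := P) (d := d))
    rw [reducedMoment_mulVec] at hMx
    have e0 := congrFun hMx 0
    have e1 := congrFun hMx 1
    have e2 := congrFun hMx 2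
    simp only [cons_val, Pi.smul_apply, smul_eq_mul] at e0 e1 e2
    refine hasEigenvalue_secondMoment_iff.2
      -- Lift isometrically by spreading x 1 evenly over the d coordinates.
      ⟨Sum.elim (fun _ => x 0) (Sum.elim (fun _ => x 1 / √d) fun _ => x 2), fun h0 => hx ?_, ?_⟩
    · have f0 := congrFun h0 (.inl ())
      have f1 := congrFun h0 (.inr (.inl ⟨0, hd⟩))
      have f2 := congrFun h0 (.inr (.inr ()))
      simp [hs0] at f0 f1 f2
      ext i
      fin_cases i <;> simp [f0, f2]
      simpa [(by lia : d ≠ 0)] using f1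
    · rw [secondMoment_mulVec hsupp hmean]
      funext k
      rcases k with _ | k | _
      · simpa using e0
      · simp only [Sum.elim_inr, Sum.elim_inl, Pi.smul_apply, smul_eq_mul]
        field_simp
        linarith
      · simp only [Sum.elim_inr, Sum.elim_inl, Pi.smul_apply, smul_eq_mul, Finset.sum_const,
          Finset.card_univ, Fintype.card_fin, nsmul_eq_mul]
        rw [← e2]
        have : (d : ℝ) * (x 1 / √d) = √d * x 1 := by
          nth_rewrite 1 [← hs]; field_simp
        rw [this]; ring
  · rintro l hl
    obtain ⟨v, hv, hRv⟩ := hasEigenvalue_secondMoment_iff.1 hl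
    rw [secondMoment_mulVec hsupp hmean] at hRv
    have e0 := congrFun hRv (.inl ())
    have e1 := fun i => congrFun hRv (.inr (.inl i))
    have e2 := congrFun hRv (.inr (.inr ()))
    simp only [Sum.elim_inr, Sum.elim_inl, Pi.smul_apply, smul_eq_mul] at e0 e1 e2
    refine Finset.min'_le _ _ ?_
    -- If the projection of v to the three-dimensional space vanishes, v is a sum-zero vector and l
    -- = m₂; otherwise the projection is an eigenvector for l.
    by_cases hx : (![v (.inl ()), (∑ i, v (.inr (.inl i))) / √d, v (.inr (.inr ()))] : Fin 3 → ℝ) = 0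
    · have f0 := congrFun hx 0
      have f2 := congrFun hx 2
      simp only [cons_val, Pi.zero_apply] at f0 f2
      obtain ⟨k, hk⟩ := Function.ne_iff.1 hv
      rcases k with _ | k | _
      · exact absurd f0 hk
      · have h := e1 k
        rw [f2, mul_zero, add_zero] at h
        rw [← mul_right_cancel₀ hk h]
        exact Finset.mem_insert_self _ _
      · exact absurd f2 hk
    · refine Finset.mem_insert_of_mem (Multiset.mem_toFinset.2 (mem_roots_cubic_iff.2 ⟨_, hx, ?_⟩))
      have hsum : mom P 2 * ∑ i, v (.inr (.inl i)) + d * mom P 3 * v (.inr (.inr ())) =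
          l * ∑ i, v (.inr (.inl i)) := by
        rw [Finset.mul_sum, Finset.mul_sum, ← Finset.sum_congr rfl fun i _ => e1 i,
          Finset.sum_add_distrib]
        simp [mul_assoc]
      rw [reducedMoment_mulVec]
      ext i
      fin_cases i
      · simpa using e0
      · simp
        field_simp
        rw [sq, hs]
        linarith
      · simp only [cons_val, Pi.smul_apply, smul_eq_mul, Fin.reduceFinMk]
        rw [← e2]
        field_simp

theorem lambdaStar_pos [IsProbabilityMeasure P] [NullSingletonClass P] (hd : 1 ≤ d)
    (hsupp : ∀ᵐ x ∂P, x ∈ Set.Icc a b) (hmean : mom P 1 = 0) : 0 < lambdaStar P d :=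
  roots_cubic_pos hd hsupp hmean _ lambdaStar_mem_roots

theorem lambdaStar_mul_le [IsProbabilityMeasure P] (hd : 1 ≤ d) (hsupp : ∀ᵐ x ∂P, x ∈ Set.Icc a b)
    (hmean : mom P 1 = 0) (v : Unit ⊕ Fin d ⊕ Unit → ℝ) :
    lambdaStar P d * (v ⬝ᵥ v) ≤
      ∫ p, (liftedRow p ⬝ᵥ v) ^ 2 ∂(Measure.pi fun _ : Fin d => P) := by
  rw [← dotProduct_secondMoment_mulVec hsupp]
  set hR := secondMoment_isHermitian (P := P) (d := d)
  refine hR.le_dotProduct_mulVec (fun i => (isLeast_lambdaStar hd hsupp hmean).2 ?_) v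
  refine hasEigenvalue_secondMoment_iff.2 ⟨_, ?_, hR.mulVec_eigenvectorBasis i⟩
  intro h
  have := hR.eigenvectorBasis.orthonormal.ne_zero i
  exact this (by ext k; exact congrFun h k)

end SecondMoment

end EDMCoherence

/-! ### Row bounds, the joint law of the points, and the final probability estimate -/

namespace EDMCoherence

open Matrix

theorem liftedRow_dotProduct_self_le {d : ℕ} {a b : ℝ} {p : Fin d → ℝ}
    (hp : ∀ j, p j ∈ Set.Icc a b) :
    liftedRow p ⬝ᵥ liftedRow p ≤
      1 + (d : ℝ) * max |a| |b| ^ 2 + (d : ℝ) ^ 2 * max |a| |b| ^ 4 := by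
  have h1 : ∀ j, p j ^ 2 ≤ max |a| |b| ^ 2 := fun j => by
    rw [← sq_abs (p j)]
    have := abs_le_max_abs_abs (hp j).1 (hp j).2
    gcongr
  have h2 : ∑ j, p j ^ 2 ≤ d * max |a| |b| ^ 2 := by
    simpa using Finset.sum_le_sum fun j (_ : j ∈ Finset.univ) => h1 j
  have h0 : 0 ≤ ∑ j, p j ^ 2 := by positivity
  have h3 : liftedRow p ⬝ᵥ liftedRow p = 1 + ∑ j, p j ^ 2 + (∑ j, p j ^ 2) ^ 2 := by
    simp [dotProduct, Fintype.sum_sum_type, liftedRow, ← sq, add_assoc]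
  have h4 : (∑ j, p j ^ 2) ^ 2 ≤ (d * max |a| |b| ^ 2) ^ 2 := by gcongr
  rw [h3]
  nlinarith

/-- Independence over pairs (i, j) gives a product law on `Fin N × Fin d`; currying turns it into
the law of N independent points. -/
theorem map_eq_pi_pi {Ω : Type*} [MeasurableSpace Ω] {μ : Measure Ω} {P : Measure ℝ}
    [IsProbabilityMeasure P] {N d : ℕ} {x : Fin N → Fin d → Ω → ℝ}
    (hmeas : ∀ i j, Measurable (x i j)) (hlaw : ∀ i j, μ.map (x i j) = P)
    (hindep : iIndepFun (fun ij : Fin N × Fin d => x ij.1 ij.2) μ) :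
    μ.map (fun ω i j => x i j ω) = Measure.pi fun _ : Fin N => Measure.pi fun _ : Fin d => P := by
  have h := hindep.map_fun_eq_pi_map fun ij : Fin N × Fin d => (hmeas ij.1 ij.2).aemeasurable
  simp only [hlaw] at h
  have h2 := Measure.infinitePi_map_curry (fun (_ : Fin N) (_ : Fin d) => P)
  simp only [Measure.infinitePi_eq_pi] at h2
  rw [← h2, ← h, Measure.map_map (MeasurableEquiv.measurable _)
    (measurable_pi_lambda _ fun ij : Fin N × Fin d => hmeas ij.1 ij.2)]
  rfl

theorem card_mul_exp_le {θ t γ K N : ℝ} (hθ : 0 < θ) (ht1 : t < 1) (hγ0 : 0 < γ) (hK : 0 < K)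
    (hN : 2 * θ * (Real.log K - Real.log γ) / (1 - t) ^ 2 ≤ N) :
    K * Real.exp (-((1 - t) ^ 2 * N / (2 * θ))) ≤ γ := by
  have ht : 0 < (1 - t) ^ 2 := by have := sub_pos.2 ht1; positivity
  rw [div_le_iff₀ ht] at hN
  have h1 : Real.log K - Real.log γ ≤ (1 - t) ^ 2 * N / (2 * θ) := by
    rw [le_div_iff₀ (by positivity)]; linarith
  calc K * Real.exp (-((1 - t) ^ 2 * N / (2 * θ)))
      ≤ K * Real.exp (Real.log γ - Real.log K) := by gcongr; linarith
    _ = γ := by rw [Real.exp_sub, Real.exp_log hγ0, Real.exp_log hK]; field_simp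

end EDMCoherence

open EDMCoherence Matrix in
theorem theorem2 {Ω : Type*} [MeasurableSpace Ω] (μ : MeasureTheory.Measure Ω)
    [MeasureTheory.IsProbabilityMeasure μ]
    (P : MeasureTheory.Measure ℝ) [MeasureTheory.IsProbabilityMeasure P]
    [MeasureTheory.NullSingletonClass P]
    (N d : ℕ) (hd : 1 ≤ d) (a b : ℝ) (ha : a < 0) (hb : 0 < b)
    (hsupp : ∀ᵐ x ∂P, x ∈ Set.Icc a b) (hmean : EDMCoherence.mom P 1 = 0)
    (x : Fin N → Fin d → Ω → ℝ) (hmeas : ∀ i j, Measurable (x i j))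
    (hlaw : ∀ i j, μ.map (x i j) = P)
    (hindep : ProbabilityTheory.iIndepFun (fun ij : Fin N × Fin d => x ij.1 ij.2) μ)
    (t γ : ℝ) (ht0 : 0 < t) (ht1 : t < 1) (hγ0 : 0 < γ) (hγ1 : γ ≤ 1) :
    -- the three roots of the cubic, with multiplicity, are real and positive
    (EDMCoherence.cubic P d).roots.card = 3 ∧
    (∀ l ∈ (EDMCoherence.cubic P d).roots, 0 < l) ∧
    -- their minimum with `m₂` is the smallest eigenvalue of the second-moment matrix
    IsLeast {l : ℝ | Module.End.HasEigenvalue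
      (Matrix.toLin' (EDMCoherence.secondMoment P d)) l} (EDMCoherence.lambdaStar P d) ∧
    -- the coherence bounds
    (2 * EDMCoherence.theta P d a b * (Real.log ((d : ℝ) + 2) - Real.log γ) / (1 - t) ^ 2
        ≤ (N : ℝ) →
      ∃ E : Set Ω, MeasurableSet E ∧ ENNReal.ofReal (1 - γ) ≤ μ E ∧ ∀ ω ∈ E,
        let Δ := EDMCoherence.edm fun i => WithLp.toLp 2 fun j => x i j ω
        Δ.rank = d + 2 ∧ Nonempty (EDMCoherence.CompactSVD Δ) ∧
        ∀ S : EDMCoherence.CompactSVD Δ,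
          S.A0 (EDMCoherence.theta P d a b / (t * ((d : ℝ) + 2))) ∧
          S.A1 (EDMCoherence.theta P d a b / (t * √((d : ℝ) + 2)))) := by
  refine ⟨card_roots_cubic, roots_cubic_pos hd hsupp hmean, isLeast_lambdaStar hd hsupp hmean,
    fun hN => ?_⟩
  have hlam := lambdaStar_pos hd hsupp hmean
  set lam := lambdaStar P d with hlamdef
  set B : ℝ := 1 + (d : ℝ) * max |a| |b| ^ 2 + (d : ℝ) ^ 2 * max |a| |b| ^ 4 with hB
  have hB0 : 0 < B := by positivity
  have hθ : theta P d a b = B / lam := rfl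
  rw [hθ] at hN ⊢
  -- The sample bound is strictly positive, because log (d + 2) > 0 ≥ log γ.
  have hN0 : 0 < N := by
    have hlog : 0 < Real.log ((d : ℝ) + 2) := Real.log_pos (by linarith [Nat.cast_nonneg (α := ℝ) d])
    have hlog2 := Real.log_nonpos hγ0.le hγ1
    have ht : 0 < (1 - t) ^ 2 := by have := sub_pos.2 ht1; positivity
    have : (0 : ℝ) < N := lt_of_lt_of_le (by
      have : 0 < Real.log ((d : ℝ) + 2) - Real.log γ := by linarith
      positivity) hN
    exact_mod_cast this
  have hcard : ((Fintype.card (Unit ⊕ Fin d ⊕ Unit) : ℕ) : ℝ) = d + 2 := by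
    simp; ring
  obtain ⟨F, hF, hFm, hFp⟩ := exists_measurableSet_le_sum_sq_dotProduct
    (ν := Measure.pi fun _ : Fin d => P) (φ := liftedRow) continuous_liftedRow.measurable hB0
    ((ae_pi_mem_Icc hsupp d).mono fun p hp => liftedRow_dotProduct_self_le fun j => hp j trivial)
    hlam (lambdaStar_mul_le hd hsupp hmean) ht0 ht1 N
  have hX : Measurable fun ω i j => x i j ω :=
    measurable_pi_lambda _ fun i => measurable_pi_lambda _ fun j => hmeas i j
  -- The row bound must hold pointwise on the event, so the almost sure support condition is built
  -- into it at no cost in probability.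
  set G : Set (Fin N → Fin d → ℝ) := {p | ∀ i j, p i j ∈ Set.Icc a b} with hG
  have hGm : MeasurableSet G := by
    simp only [hG, Set.ofPred_forall]
    exact MeasurableSet.iInter fun i => MeasurableSet.iInter fun j =>
      (measurable_pi_apply j).comp (measurable_pi_apply i) measurableSet_Icc
  have hGae : μ ((fun ω i j => x i j ω) ⁻¹' Gᶜ) = 0 := by
    have h : ∀ i j, ∀ᵐ ω ∂μ, x i j ω ∈ Set.Icc a b := fun i j => by
      rw [← hlaw i j] at hsupp
      exact ae_of_ae_map (hmeas i j).aemeasurable hsupp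
    exact ae_all_iff.2 fun i => ae_all_iff.2 fun j => h i j
  refine ⟨(fun ω i j => x i j ω) ⁻¹' (F ∩ G), hX (hF.inter hGm), ?_, ?_⟩
  · have hFc : μ ((fun ω i j => x i j ω) ⁻¹' Fᶜ) ≤ ENNReal.ofReal γ := by
      rw [← Measure.map_apply hX hF.compl, map_eq_pi_pi hmeas hlaw hindep]
      refine hFm.trans (ENNReal.ofReal_le_ofReal ?_)
      rw [hcard]
      have h := card_mul_exp_le (by positivity : 0 < B / lam) ht1 hγ0
        (by positivity : (0 : ℝ) < d + 2) hN
      have he : (1 - t) ^ 2 * N * lam / (2 * B) = (1 - t) ^ 2 * N / (2 * (B / lam)) := by field_simp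
      rwa [he]
    have hc : μ ((fun ω i j => x i j ω) ⁻¹' (F ∩ G))ᶜ ≤ ENNReal.ofReal γ := by
      rw [← Set.preimage_compl, Set.compl_inter, Set.preimage_union]
      refine (measure_union_le _ _).trans ?_
      rw [hGae, add_zero]
      exact hFc
    rw [ENNReal.ofReal_sub _ hγ0.le, ENNReal.ofReal_one, tsub_le_iff_right,
      ← prob_add_prob_compl (μ := μ) (hX (hF.inter hGm))]
    gcongr
  · rintro ω ⟨hωF, hωG⟩
    have hlb := hFp _ hωF
    have hN' : (0 : ℝ) < N := by exact_mod_cast hN0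
    have hpos : 0 < t * N * lam := by positivity
    refine ⟨rank_edm hpos hlb, nonempty_compactSVD_of_isHermitian
      (isHermitian_iff_isSymm.2 (edm_isSymm _)), fun S => ?_⟩
    have h := edm_coherence hN0 hpos hlb hB0
      (fun i => liftedRow_dotProduct_self_le fun j => hωG i j) S
    have e1 : (N : ℝ) * (B / (t * N * lam)) / (d + 2) = B / lam / (t * ((d : ℝ) + 2)) := by
      field_simp
    have e2 : (N : ℝ) * (B / (t * N * lam)) / √(d + 2) = B / lam / (t * √((d : ℝ) + 2)) := by
      field_simp
    rwa [e1, e2] at h
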